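/- Let $M$ be a connected smooth $n$-manifold with a Riemannian metric $h$ whose Levi-Civita connection $\nabla$ is generic: at each point $x$ there are $\xi_1,\xi_2\in T_xM$ such that the curvature operator $R(\xi_1,\xi_2):T_xM\to T_xM$ has $n$ distinct complex eigenvalues. Metrics are written with contravariant indices, i.e. as sections of $TM\otimes TM$ (bilinear forms on cotangent spaces). Put $m=\lfloor n/2\rfloor$. Let $\mathcal U$ be a cover of $M$ by connected open sets such that $U\cap V$ is connected or empty for all $U,V\in\mathcal U$, and such that on each $U\in\mathcal U$ there are given smooth vector fields $\xi_1,\xi_2$ for which $R(\xi_1,\xi_2)$ has $n$ distinct eigenvalues at every point of $U$, together with a smooth frame $(X_1,\dots,X_n)$ on $U$ such that $X_1\pm iX_2,\dots,X_{2m-1}\pm iX_{2m}$, and $X_n$ if $n$ is odd, are eigenvector fields of $R(\xi_1,\xi_2)$. Let $Y_j=X_j/|X_j|_h$, and define connection forms by $\nabla Y_j=\sum_i Y_i\otimes\omega^i_j$. Let $P_1(U),\dots,P_{\beta(U)}(U)$ be the classes of the equivalence relation on $\{1,\dots,n\}$ generated by the pairs $(i,j)$ for which $\omega^i_j$ does not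 vanish identically on $U$, and let $\bar Q_k(U)\subseteq TU$ be the subbundle spanned by the $Y_j$ with $j\in P_k(U)$. On the set of pairs $(k,U)$ with $U\in\mathcal U$ and $1\le k\le\beta(U)$, take the equivalence relation generated by $(k,U)\sim(l,V)$ whenever $U\cap V\ne\emptyset$ and $\bar Q_k(U)\cap\bar Q_l(V)$ is not the zero distribution on $U\cap V$, and let $I_a$ denote its classes. Then there are finitely many classes $I_1,\dots,I_A$. The distributions $Q_a|_U:=\bigoplus_{(k,U)\in I_a}\bar Q_k(U)$ are well defined on $M$ and nowhere zero, and $TM=Q_1\oplus\dots\oplus Q_A$. Let $T^*M=Q_1^*\oplus\dots\oplus Q_A^*$ be the dual decomposition, and let $h_a$ be the restriction of $h$ to $Q_a$, that is, the unique section of $TM\otimes TM$ whose restriction to $Q_b^*\times Q_c^*$ is that of $h$ if $b=c=a$, and $0$ otherwise. Each $h_a$ is symmetric and positive semi-definite. Finally, a contravariant $2$-tensor field $g$ on $M$ is a smooth Riemannian metric with $\nabla g=0$ if and only if $g=\sum_{a=1}^A c_a h_a$ for some constants $c_a>0$. -/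

import Mathlib

open Bundle FiberBundle Set Filter
open scoped Manifold ContDiff Topology TensorProduct

noncomputable section

namespace ParallelMetric

variable {n : ℕ} {M : Type*} [TopologicalSpace M] [ChartedSpace (EuclideanSpace ℝ (Fin n)) M]

/-! ### Metrics, connections, curvature -/

/-- Smooth Riemannian metrics on `M` (as covariant tensors). -/
abbrev Metric (n : ℕ) (M : Type*) [TopologicalSpace M]
    [ChartedSpace (EuclideanSpace ℝ (Fin n)) M] [IsManifold (𝓡 n) ∞ M] : Type _ :=
  ContMDiffRiemannianMetric (𝓡 n) ∞ (EuclideanSpace ℝ (Fin n)) (fun x : M ↦ TangentSpace (𝓡 n) x)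

/-- Affine connections on `M`; `cov Y x v` is `∇_v Y` at `x`. -/
abbrev Connection (n : ℕ) (M : Type*) [TopologicalSpace M]
    [ChartedSpace (EuclideanSpace ℝ (Fin n)) M] [IsManifold (𝓡 n) ∞ M] : Type _ :=
  CovariantDerivative (𝓡 n) (EuclideanSpace ℝ (Fin n)) (fun x : M ↦ TangentSpace (𝓡 n) x)

variable [IsManifold (𝓡 n) ∞ M]

/-- `∇ g = 0`. -/
def IsParallel (cov : Connection n M) (g : Metric n M) : Prop :=
  letI : RiemannianBundle (fun x : M ↦ TangentSpace (𝓡 n) x) := ⟨g.toRiemannianMetric⟩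
  haveI : IsContMDiffRiemannianBundle (𝓡 n) 1 (EuclideanSpace ℝ (Fin n))
    (fun x : M ↦ TangentSpace (𝓡 n) x) := IsContMDiffRiemannianBundle.of_le (n := ∞) (by norm_cast)
  cov.IsMetricCompatible

theorem isParallel_iff (cov : Connection n M) (g : Metric n M) : IsParallel cov g ↔
    ∀ {x : M} {X σ τ : Π x : M, TangentSpace (𝓡 n) x},
      MDifferentiableAt (𝓡 n) (𝓡 n).tangent (T% X) x →
      MDifferentiableAt (𝓡 n) (𝓡 n).tangent (T% σ) x →
      MDifferentiableAt (𝓡 n) (𝓡 n).tangent (T% τ) x →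
      mvfderiv (𝓡 n) (fun y ↦ g.inner y (σ y) (τ y)) x (X x) =
        g.inner x (cov σ x (X x)) (τ x) + g.inner x (σ x) (cov τ x (X x)) := by
  let : RiemannianBundle (fun x : M ↦ TangentSpace (𝓡 n) x) := ⟨g.toRiemannianMetric⟩
  have : IsContMDiffRiemannianBundle (𝓡 n) 1 (EuclideanSpace ℝ (Fin n))
    (fun x : M ↦ TangentSpace (𝓡 n) x) := IsContMDiffRiemannianBundle.of_le (n := ∞) (by norm_cast)
  exact CovariantDerivative.isMetricCompatible_iff cov

/-- `cov` is the Levi-Civita connection of `h`. -/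
def IsLeviCivita (cov : Connection n M) (h : Metric n M) : Prop :=
  cov.torsion = 0 ∧ IsParallel cov h

/-- `∇_X ∇_Y Z - ∇_Y ∇_X Z - ∇_[X,Y] Z`. -/
def curvatureField (cov : Connection n M) (X Y Z : Π x : M, TangentSpace (𝓡 n) x) :
    Π x : M, TangentSpace (𝓡 n) x := fun x ↦
  cov (fun y ↦ cov Z y (Y y)) x (X x) - cov (fun y ↦ cov Z y (X y)) x (Y x)
    - cov Z x (VectorField.mlieBracket (𝓡 n) X Y x)

/-- Near `x`, the extension of a tangent vector at `x` depends linearly on it. -/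
theorem extend_add {x : M} (v w : TangentSpace (𝓡 n) x) :
    ∀ᶠ y in 𝓝 x, extend (EuclideanSpace ℝ (Fin n)) (v + w) y =
      extend (EuclideanSpace ℝ (Fin n)) v y + extend (EuclideanSpace ℝ (Fin n)) w y := by
  have hx := FiberBundle.mem_baseSet_trivializationAt' (F := EuclideanSpace ℝ (Fin n))
    (E := fun x : M ↦ TangentSpace (𝓡 n) x) x
  have := ((trivializationAt (EuclideanSpace ℝ (Fin n))
    (fun x : M ↦ TangentSpace (𝓡 n) x) x).linear ℝ hx).map_add v w
  filter_upwards [(trivializationAt (EuclideanSpace ℝ (Fin n))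
    (fun x : M ↦ TangentSpace (𝓡 n) x) x).open_baseSet.mem_nhds hx] with y hy
  simp only [extend]
  rw [this]
  have key := ((trivializationAt (EuclideanSpace ℝ (Fin n))
    (fun x : M ↦ TangentSpace (𝓡 n) x) x).symmL ℝ y).map_add
  simp only [Trivialization.symmL_apply _ hy] at key
  exact key _ _

theorem extend_smul {x : M} (c : ℝ) (v : TangentSpace (𝓡 n) x) :
    ∀ᶠ y in 𝓝 x, extend (EuclideanSpace ℝ (Fin n)) (c • v) y =
      c • extend (EuclideanSpace ℝ (Fin n)) v y := by
  have hx := FiberBundle.mem_baseSet_trivializationAt' (F := EuclideanSpace ℝ (Fin n))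
    (E := fun x : M ↦ TangentSpace (𝓡 n) x) x
  have := ((trivializationAt (EuclideanSpace ℝ (Fin n))
    (fun x : M ↦ TangentSpace (𝓡 n) x) x).linear ℝ hx).map_smul c v
  filter_upwards [(trivializationAt (EuclideanSpace ℝ (Fin n))
    (fun x : M ↦ TangentSpace (𝓡 n) x) x).open_baseSet.mem_nhds hx] with y hy
  simp only [extend]
  rw [this]
  have key := ((trivializationAt (EuclideanSpace ℝ (Fin n))
    (fun x : M ↦ TangentSpace (𝓡 n) x) x).symmL ℝ y).map_smul
  simp only [Trivialization.symmL_apply _ hy] at key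
  exact key _ _

theorem mdifferentiable_extend_eventually {x : M} (v : TangentSpace (𝓡 n) x) :
    ∀ᶠ y in 𝓝 x, MDifferentiableAt (𝓡 n) (𝓡 n).tangent
      (T% (extend (EuclideanSpace ℝ (Fin n)) v)) y := by
  obtain ⟨s, hs, hsv⟩ := exists_contMDiffOn_extend (k := ∞) (𝓡 n) (EuclideanSpace ℝ (Fin n)) v
  filter_upwards [eventually_mem_nhds_iff.2 hs] with y hy
  exact (hsv.contMDiffAt hy).mdifferentiableAt (by simp)

theorem mdifferentiableAt_cov_extend [T2Space M] (cov : Connection n M)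
    [hc : cov.ContMDiffCovariantDerivative ∞] {x : M} (v w : TangentSpace (𝓡 n) x) :
    MDifferentiableAt (𝓡 n) (𝓡 n).tangent
      (T% (fun y ↦ cov (extend (EuclideanSpace ℝ (Fin n)) v) y
      (extend (EuclideanSpace ℝ (Fin n)) w y))) x := by
  obtain ⟨s, hs, hsv⟩ := exists_contMDiffOn_extend (k := ∞) (𝓡 n) (EuclideanSpace ℝ (Fin n)) v
  obtain ⟨t, hts, hto, hxt⟩ := mem_nhds_iff.1 hs
  obtain ⟨ψ, -, hψ⟩ := (SmoothBumpFunction.nhds_basis_tsupport (I := 𝓡 n) x).mem_iff.1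
    (hto.mem_nhds hxt)
  set V := extend (EuclideanSpace ℝ (Fin n)) v
  have h1 : ContMDiff (𝓡 n) (𝓡 n).tangent ∞ (T% ((ψ : M → ℝ) • V)) := by
    intro y
    by_cases hy : y ∈ tsupport ψ
    · exact ContMDiffAt.smul_section ψ.contMDiffAt
        ((hsv.mono hts).contMDiffAt (hto.mem_nhds (hψ hy)))
    · have : ∀ᶠ z in 𝓝 y, ((ψ : M → ℝ) • V) z = 0 := by
        filter_upwards [notMem_tsupport_iff_eventuallyEq.1 hy] with z hz
        simp [hz]
      refine (contMDiff_zeroSection ℝ (TangentSpace (𝓡 n) (M := M)) y).congr_of_eventuallyEq ?_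
      filter_upwards [this] with z hz
      simp [hz, zeroSection]
  have h2 := (hc.contMDiff.contMDiff (σ := (ψ : M → ℝ) • V) h1.contMDiffOn).contMDiffAt
    (x := x) univ_mem
  have h3 := (h2.mdifferentiableAt (by simp)).clm_bundle_apply
    (mdifferentiableAt_extend (𝓡 n) (EuclideanSpace ℝ (Fin n)) w)
  refine h3.congr_of_eventuallyEq ?_
  filter_upwards [ψ.eventuallyEq_one.eventuallyEq_nhds, hto.mem_nhds hxt] with y hy hyt
  congr 2
  refine cov.isCovariantDerivativeOnUniv.congr_of_eventuallyEq
    (((hsv.mono hts).contMDiffAt (hto.mem_nhds hyt)).mdifferentiableAt (by simp))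
    (h1.mdifferentiableAt (by simp)) univ_mem ?_
  filter_upwards [hy] with z hz
  simp [hz]

/-- Near `x`, `∇` is additive on extensions of tangent vectors at `x`. -/
theorem cov_extend_add (cov : Connection n M) {x : M} (v w : TangentSpace (𝓡 n) x) :
    ∀ᶠ y in 𝓝 x, cov (extend (EuclideanSpace ℝ (Fin n)) (v + w)) y =
      cov (extend (EuclideanSpace ℝ (Fin n)) v) y +
        cov (extend (EuclideanSpace ℝ (Fin n)) w) y := by
  filter_upwards [mdifferentiable_extend_eventually v, mdifferentiable_extend_eventually w,
    mdifferentiable_extend_eventually (v + w), (extend_add v w).eventually_nhds] with y hv hw hvw h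
  exact (cov.isCovariantDerivativeOnUniv.congr_of_eventuallyEq hvw
    (mdifferentiableAt_add_section hv hw) univ_mem h).trans
    (cov.isCovariantDerivativeOnUniv.add hv hw)

theorem cov_extend_smul (cov : Connection n M) {x : M} (c : ℝ) (v : TangentSpace (𝓡 n) x) :
    ∀ᶠ y in 𝓝 x, cov (extend (EuclideanSpace ℝ (Fin n)) (c • v)) y =
      c • cov (extend (EuclideanSpace ℝ (Fin n)) v) y := by
  filter_upwards [mdifferentiable_extend_eventually v,
    mdifferentiable_extend_eventually (c • v), (extend_smul c v).eventually_nhds] with y hv hcv h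
  exact (cov.isCovariantDerivativeOnUniv.congr_of_eventuallyEq hcv
    (mdifferentiableAt_const.smul_section hv) univ_mem h).trans
    (cov.isCovariantDerivativeOnUniv.smul_const c hv)

/-- The curvature operator `R(ξ₁, ξ₂)` on `T_x M`. -/
def curvature [T2Space M] (cov : Connection n M) [cov.ContMDiffCovariantDerivative ∞] {x : M}
    (ξ₁ ξ₂ : TangentSpace (𝓡 n) x) : TangentSpace (𝓡 n) x →ₗ[ℝ] TangentSpace (𝓡 n) x where
  toFun ζ := curvatureField cov (extend (EuclideanSpace ℝ (Fin n)) ξ₁)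
    (extend (EuclideanSpace ℝ (Fin n)) ξ₂) (extend (EuclideanSpace ℝ (Fin n)) ζ) x
  map_add' v w := by
    have key (ξ : TangentSpace (𝓡 n) x) := (cov.isCovariantDerivativeOnUniv.congr_of_eventuallyEq
      (mdifferentiableAt_cov_extend cov (v + w) ξ)
      (mdifferentiableAt_add_section (mdifferentiableAt_cov_extend cov v ξ)
        (mdifferentiableAt_cov_extend cov w ξ)) univ_mem (by
        filter_upwards [cov_extend_add cov v w] with y hy
        simp [hy])).trans
      (cov.isCovariantDerivativeOnUniv.add (mdifferentiableAt_cov_extend cov v ξ)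
        (mdifferentiableAt_cov_extend cov w ξ))
    simp only [curvatureField]
    rw [(cov_extend_add cov v w).self_of_nhds]
    erw [key, key]
    simp only [add_apply]
    abel
  map_smul' c v := by
    have key (ξ : TangentSpace (𝓡 n) x) := (cov.isCovariantDerivativeOnUniv.congr_of_eventuallyEq
      (mdifferentiableAt_cov_extend cov (c • v) ξ)
      (mdifferentiableAt_const.smul_section (mdifferentiableAt_cov_extend cov v ξ)) univ_mem (by
        filter_upwards [cov_extend_smul cov c v] with y hy
        simp [hy])).trans
      (cov.isCovariantDerivativeOnUniv.smul_const c (mdifferentiableAt_cov_extend cov v ξ))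
    simp only [curvatureField]
    rw [(cov_extend_smul cov c v).self_of_nhds]
    erw [key, key]
    simp only [smul_apply, RingHom.id_apply, smul_sub]

/-- At each point some curvature operator has `n` distinct complex eigenvalues. -/
def IsGeneric [T2Space M] (cov : Connection n M) [cov.ContMDiffCovariantDerivative ∞] : Prop :=
  ∀ x : M, ∃ ξ₁ ξ₂ : TangentSpace (𝓡 n) x,
    {μ : ℂ | Module.End.HasEigenvalue ((curvature cov ξ₁ ξ₂).baseChange ℂ) μ}.ncard = n

/-! ### Contravariant tensors -/

/-- Contravariant 2-tensor fields: a bilinear form on each cotangent space. -/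
abbrev CoTensor (n : ℕ) (M : Type*) [TopologicalSpace M]
    [ChartedSpace (EuclideanSpace ℝ (Fin n)) M] : Type _ :=
  Π x : M, LinearMap.BilinForm ℝ (TangentSpace (𝓡 n) x →L[ℝ] ℝ)

instance (x : M) : FiniteDimensional ℝ (TangentSpace (𝓡 n) x) :=
  inferInstanceAs (FiniteDimensional ℝ (EuclideanSpace ℝ (Fin n)))

/-- The isomorphism `v ↦ g(v, ·)` from `T_x M` to `T_x^* M`. -/
def Metric.flat (g : Metric n M) (x : M) :
    TangentSpace (𝓡 n) x ≃ₗ[ℝ] (TangentSpace (𝓡 n) x →L[ℝ] ℝ) :=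
  haveI : T2Space (TangentSpace (𝓡 n) x) :=
    FiberBundle.t2Space (EuclideanSpace ℝ (Fin n)) (fun x : M ↦ TangentSpace (𝓡 n) x) x
  LinearMap.linearEquivOfInjective (g.inner x).toLinearMap
    ((injective_iff_map_eq_zero _).2 fun v hv ↦ by
      by_contra hne
      have h0 : g.inner x v v = 0 := by
        have := congrArg (fun σ : TangentSpace (𝓡 n) x →L[ℝ] ℝ ↦ σ v) hv
        simpa using this
      exact (g.pos x v hne).ne' h0)
    (Subspace.dual_finrank_eq.symm.trans (LinearEquiv.finrank_eq
      (LinearMap.toContinuousLinearMap :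
        (TangentSpace (𝓡 n) x →ₗ[ℝ] ℝ) ≃ₗ[ℝ] (TangentSpace (𝓡 n) x →L[ℝ] ℝ))))

/-- The metric `g` with contravariant indices. -/
def Metric.contra (g : Metric n M) : CoTensor n M := fun x ↦
  LinearMap.mk₂ ℝ (fun σ τ ↦ g.inner x ((g.flat x).symm σ) ((g.flat x).symm τ))
    (by simp) (by simp) (by simp) (by simp)

/-- `G` is a smooth Riemannian metric, in contravariant form, with `∇ G = 0`. -/
def IsParallelMetric (cov : Connection n M) (G : CoTensor n M) : Prop :=
  ∃ g : Metric n M, g.contra = G ∧ IsParallel cov g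

/-! ### Eigenframes and the local decomposition -/

/-- Index set of a frame: `n / 2` pairs, and one more index if `n` is odd. -/
abbrev FrameIdx (n : ℕ) : Type := (Fin (n / 2) × Fin 2) ⊕ Fin (n % 2)

/-- `X₁ + iX₂, X₁ - iX₂, …, X₂ₘ₋₁ + iX₂ₘ, X₂ₘ₋₁ - iX₂ₘ, (Xₙ)`. -/
def complexFrame {W : Type*} [AddCommGroup W] [Module ℝ W] (X : FrameIdx n → W) :
    FrameIdx n → ℂ ⊗[ℝ] W
  | .inl (k, 0) => 1 ⊗ₜ[ℝ] X (.inl (k, 0)) + Complex.I ⊗ₜ[ℝ] X (.inl (k, 1))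
  | .inl (k, 1) => 1 ⊗ₜ[ℝ] X (.inl (k, 0)) - Complex.I ⊗ₜ[ℝ] X (.inl (k, 1))
  | .inr r => 1 ⊗ₜ[ℝ] X (.inr r)

/-- Smooth vector fields `ξ₁, ξ₂` on `U` such that `R(ξ₁, ξ₂)` has `n` distinct eigenvalues at each
point of `U`, with a smooth frame `X` on `U` for which `X₁ ± iX₂, …, (Xₙ)` are eigenvector fields.
Values outside `U` are irrelevant. -/
structure EigenFrame [T2Space M] (cov : Connection n M) [cov.ContMDiffCovariantDerivative ∞]
    (U : Set M) where
  ξ₁ : Π x : M, TangentSpace (𝓡 n) x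
  ξ₂ : Π x : M, TangentSpace (𝓡 n) x
  smooth₁ : ContMDiffOn (𝓡 n) (𝓡 n).tangent ∞ (T% ξ₁) U
  smooth₂ : ContMDiffOn (𝓡 n) (𝓡 n).tangent ∞ (T% ξ₂) U
  X : FrameIdx n → Π x : M, TangentSpace (𝓡 n) x
  isFrame : IsLocalFrameOn (𝓡 n) (EuclideanSpace ℝ (Fin n)) ∞ X U
  eigenvalue : FrameIdx n → M → ℂ
  distinct : ∀ u ∈ U, Function.Injective (eigenvalue · u)
  eigen : ∀ u ∈ U, ∀ i, (curvature cov (ξ₁ u) (ξ₂ u)).baseChange ℂ (complexFrame (X · u) i) =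
    eigenvalue i u • complexFrame (X · u) i

namespace EigenFrame

variable [T2Space M] {cov : Connection n M} [cov.ContMDiffCovariantDerivative ∞] {U : Set M}
  (F : EigenFrame cov U) (h : Metric n M)

/-- `Y_i`, the frame `X_i` normalized with respect to `h`. -/
def Y (i : FrameIdx n) : Π x : M, TangentSpace (𝓡 n) x := fun x ↦
  (Real.sqrt (h.inner x (F.X i x) (F.X i x)))⁻¹ • F.X i x

theorem isUnit_norm_inv {u : M} (hu : u ∈ U) (i : FrameIdx n) :
    IsUnit (Real.sqrt (h.inner u (F.X i u) (F.X i u)))⁻¹ := by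
  have := h.pos u _ ((F.isFrame.linearIndependent hu).ne_zero i)
  exact (inv_pos.2 (Real.sqrt_pos.2 this)).ne'.isUnit

/-- The frame `Y` at a point of `U`, as a basis. -/
def basisY {u : M} (hu : u ∈ U) : Module.Basis (FrameIdx n) ℝ (TangentSpace (𝓡 n) u) :=
  (F.isFrame.toBasisAt hu).isUnitSMul (F.isUnit_norm_inv h hu)

theorem basisY_apply {u : M} (hu : u ∈ U) (i : FrameIdx n) : F.basisY h hu i = F.Y h i u := by
  simp [basisY, Y, Module.Basis.isUnitSMul_apply]

/-- The connection form `ω^i_j` at `u`, where `∇ Y_j = ∑ i, Y_i ⊗ ω^i_j`. -/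
def connectionForm {u : M} (hu : u ∈ U) (i j : FrameIdx n) : TangentSpace (𝓡 n) u →ₗ[ℝ] ℝ :=
  (F.basisY h hu).coord i ∘ₗ (cov (F.Y h j) u).toLinearMap

/-- `r(U)`: the equivalence relation generated by `ω^i_j(u) ≠ 0` for some `u ∈ U`. -/
def blockSetoid : Setoid (FrameIdx n) :=
  Relation.EqvGen.setoid fun i j ↦ ∃ (u : M) (hu : u ∈ U), F.connectionForm h hu i j ≠ 0

/-- The blocks `P_1(U), …, P_β(U)` of the partition of the index set. -/
abbrev LocalBlock : Type := Quotient (F.blockSetoid h)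

/-- The span of the `Y_j` with `j` in the block `p`, at the point `x`. -/
def localBundle (p : F.LocalBlock h) (x : M) : Submodule ℝ (TangentSpace (𝓡 n) x) :=
  Submodule.span ℝ {v | ∃ j, Quotient.mk (F.blockSetoid h) j = p ∧ F.Y h j x = v}

end EigenFrame

/-! ### The global decomposition -/

/-- A cover of `M` by connected open sets carrying eigenframes, with connected (or empty) pairwise
intersections. -/
structure EigenCover [T2Space M] (cov : Connection n M)
    [cov.ContMDiffCovariantDerivative ∞] where
  sets : Set (Set M)
  isOpen : ∀ U ∈ sets, IsOpen U
  isConnected : ∀ U ∈ sets, IsConnected U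
  covers : ⋃₀ sets = univ
  inter : ∀ U ∈ sets, ∀ V ∈ sets, IsPreconnected (U ∩ V)
  frame : ∀ U : sets, EigenFrame cov (U : Set M)

namespace EigenCover

variable [T2Space M] {cov : Connection n M} [cov.ContMDiffCovariantDerivative ∞]
  (C : EigenCover cov) (h : Metric n M)

/-- The set `I` of pairs of a set of the cover and a local block on it. -/
abbrev Index : Type _ := Σ U : C.sets, (C.frame U).LocalBlock h

/-- The equivalence relation on `I` generated by: `U ∩ V` is nonempty and the intersection of the
two local distributions is not the zero distribution on `U ∩ V`. -/
def indexSetoid : Setoid (C.Index h) :=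
  Relation.EqvGen.setoid fun p q ↦ ∃ x ∈ (p.1 : Set M) ∩ (q.1 : Set M),
    (C.frame p.1).localBundle h p.2 x ⊓ (C.frame q.1).localBundle h q.2 x ≠ ⊥

/-- The blocks `I_1, …, I_A`. -/
abbrev Block : Type _ := Quotient (C.indexSetoid h)

/-- `Q_a(U)` at the point `x`. -/
def distOn (a : C.Block h) (U : C.sets) (x : M) : Submodule ℝ (TangentSpace (𝓡 n) x) :=
  ⨆ (p : (C.frame U).LocalBlock h) (_ : Quotient.mk (C.indexSetoid h) ⟨U, p⟩ = a),
    (C.frame U).localBundle h p x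

/-- `Q_a` at the point `x`. -/
def dist (a : C.Block h) (x : M) : Submodule ℝ (TangentSpace (𝓡 n) x) :=
  ⨆ (U : C.sets) (_ : x ∈ (U : Set M)), C.distOn h a U x

/-- The dual subbundle `Q_a^*` at `x`: covectors vanishing on `Q_b` for all `b ≠ a`. -/
def dualDist (a : C.Block h) (x : M) : Submodule ℝ (TangentSpace (𝓡 n) x →L[ℝ] ℝ) where
  carrier := {σ | ∀ b, b ≠ a → ∀ v ∈ C.dist h b x, σ v = 0}
  add_mem' hσ hτ b hb v hv := by simp [hσ b hb v hv, hτ b hb v hv]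
  zero_mem' := by simp
  smul_mem' c σ hσ b hb v hv := by simp [hσ b hb v hv]

open Classical in
/-- `H a` is `h` restricted to `Q_a`: on `Q_b^* × Q_c^*` it is `h` if `b = c = a`, and zero
otherwise. -/
def IsRestriction (H : C.Block h → CoTensor n M) : Prop :=
  ∀ (a b c : C.Block h) (x : M), ∀ σ ∈ C.dualDist h b x, ∀ τ ∈ C.dualDist h c x,
    H a x σ τ = if b = a ∧ c = a then h.contra x σ τ else 0

end EigenCover

end ParallelMetric

end

/-! A symmetric form B with ∇B = 0 satisfies B(Rv, w) + B(v, Rw) = 0 for every curvature operator R: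
apply [X, Y]f = XYf − YXf to f = B(V, W), and the mixed terms cancel
(`IsParallelOn.curvature_skew`). Take R = R(ξ₁, ξ₂). Skewness for h makes its eigenvalues imaginary,
and distinctness makes R rotate the coordinate planes of X with nonzero speeds whose squares differ
(`exists_rotation_speeds`). Skewness for B then forces B to be diagonal in X (`diagonal_of_skew`).
With B = h this makes Y orthonormal and ω antisymmetric.

For a parallel metric g, ω^j_j = 0 makes g(Y_j, Y_j) constant on U, and differentiating g(Y_i, Y_j)
= 0 gives ω^i_j (g(Y_i, Y_i) − g(Y_j, Y_j)) = 0. Hence g is a constant multiple of h on each local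
block (`exists_inner_Y_eq`). Conversely, ∑ d_j h(Y_j, ·)² is parallel when d is constant on the
blocks (`isParallelOn_blockForm`).

To pass from U to V, apply diagonality to these block forms: being parallel on U, they are diagonal
in the frame of V, so each frame vector of V lies in a single local block of U
(`exists_Y_mem_localBundle`). This makes Q_a independent of the set used. Connectedness of M makes
every class appear on every set, so there are finitely many classes. The constants of linked blocks
agree, and conversely the scaled local forms glue. Passing to contravariant indices inverts the
constants. -/

noncomputable section

namespace ParallelMetric

variable {n : ℕ} {M : Type*} [TopologicalSpace M] [ChartedSpace (EuclideanSpace ℝ (Fin n)) M]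
variable [IsManifold (𝓡 n) ∞ M]

/-! ### Lie brackets as commutators of derivations -/

theorem _root_.Filter.EventuallyEq.mvfderiv_eq {N : Type*} [TopologicalSpace N]
    [ChartedSpace (EuclideanSpace ℝ (Fin n)) N] {f g : N → ℝ} {x : N} (h : f =ᶠ[𝓝 x] g) :
    mvfderiv (𝓡 n) f x = mvfderiv (𝓡 n) g x := by
  ext v
  exact congr($(h.mfderiv_eq (I := 𝓡 n) (I' := 𝓘(ℝ))) v)

-- Two applications of the Leibniz rule. The coefficient of Z carries the second derivative of f,
-- which the Jacobi identity below isolates.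
open VectorField in
theorem mlieBracket_smul_comm {f : M → ℝ} {X Y Z : Π x : M, TangentSpace (𝓡 n) x} {x : M}
    (hf : ContMDiffAt (𝓡 n) 𝓘(ℝ) ∞ f x)
    (hY : ContMDiffAt (𝓡 n) (𝓡 n).tangent ∞ (T% Y) x)
    (hZ : ContMDiffAt (𝓡 n) (𝓡 n).tangent ∞ (T% Z) x)
    (hYf : MDifferentiableAt (𝓡 n) 𝓘(ℝ) (fun y ↦ mvfderiv (𝓡 n) f y (Y y)) x) :
    mlieBracket (𝓡 n) X (mlieBracket (𝓡 n) Y (f • Z)) x =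
      mvfderiv (𝓡 n) (fun y ↦ mvfderiv (𝓡 n) f y (Y y)) x (X x) • Z x +
      mvfderiv (𝓡 n) f x (Y x) • mlieBracket (𝓡 n) X Z x +
      mvfderiv (𝓡 n) f x (X x) • mlieBracket (𝓡 n) Y Z x +
      f x • mlieBracket (𝓡 n) X (mlieBracket (𝓡 n) Y Z) x := by
  have hYZ : MDifferentiableAt (𝓡 n) (𝓡 n).tangent (T% (mlieBracket (𝓡 n) Y Z)) x := by
    have : IsManifold (𝓡 n) ((⊤ : ℕ∞) + 1) M := by simpa using ‹IsManifold (𝓡 n) ∞ M›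
    have : IsManifold (𝓡 n) (minSmoothness ℝ 2) M := by
      simpa using (inferInstance : IsManifold (𝓡 n) 2 M)
    exact (ContMDiffAt.mlieBracket_vectorField (m := 1) (n := ⊤) hY hZ
      (by simp; norm_cast)).mdifferentiableAt (by simp)
  have hfx := hf.mdifferentiableAt (by simp)
  have hZx := hZ.mdifferentiableAt (by simp)
  have key : mlieBracket (𝓡 n) Y (f • Z) =ᶠ[𝓝 x]
      (fun y ↦ mvfderiv (𝓡 n) f y (Y y)) • Z + f • mlieBracket (𝓡 n) Y Z := by
    filter_upwards [(contMDiffAt_iff_contMDiffAt_nhds (n := 1) (by simp)).1 (hf.of_le (by simp)),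
      (contMDiffAt_iff_contMDiffAt_nhds (n := 1) (by simp)).1 (hZ.of_le (by simp))] with y hfy hZy
    exact mlieBracket_smul_right (hfy.mdifferentiableAt (by simp))
      (hZy.mdifferentiableAt (by simp))
  rw [(EventuallyEq.refl _ X).mlieBracket_vectorField_eq key,
    mlieBracket_add_right (hYf.smul_section hZx) (hfx.smul_section hYZ),
    mlieBracket_smul_right hYf hZx, mlieBracket_smul_right hfx hYZ]
  abel

open VectorField in
/-- The derivative along a Lie bracket is the commutator of the derivatives. -/
theorem mvfderiv_mlieBracket {f : M → ℝ} {X Y : Π x : M, TangentSpace (𝓡 n) x} {x : M}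
    (hf : ContMDiffAt (𝓡 n) 𝓘(ℝ) ∞ f x)
    (hX : ContMDiffAt (𝓡 n) (𝓡 n).tangent ∞ (T% X) x)
    (hY : ContMDiffAt (𝓡 n) (𝓡 n).tangent ∞ (T% Y) x)
    (hXf : MDifferentiableAt (𝓡 n) 𝓘(ℝ) (fun y ↦ mvfderiv (𝓡 n) f y (X y)) x)
    (hYf : MDifferentiableAt (𝓡 n) 𝓘(ℝ) (fun y ↦ mvfderiv (𝓡 n) f y (Y y)) x) :
    mvfderiv (𝓡 n) f x (mlieBracket (𝓡 n) X Y x) =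
      mvfderiv (𝓡 n) (fun y ↦ mvfderiv (𝓡 n) f y (Y y)) x (X x) -
      mvfderiv (𝓡 n) (fun y ↦ mvfderiv (𝓡 n) f y (X y)) x (Y x) := by
  have : IsManifold (𝓡 n) ((⊤ : ℕ∞) + 1) M := by simpa using ‹IsManifold (𝓡 n) ∞ M›
  have : IsManifold (𝓡 n) (minSmoothness ℝ 3) M := by
    simpa using (IsManifold.of_le (n := ∞) (by norm_cast) : IsManifold (𝓡 n) 3 M)
  have h2 : minSmoothness ℝ 2 ≤ ∞ := by simp; norm_cast
  -- The Jacobi identity for X, Y, f • Z, compared with the one for X, Y, Z, leaves only multiples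
  -- of Z x. A nonzero Z x yields the claim; in dimension 0 both sides vanish.
  rcases subsingleton_or_nontrivial (TangentSpace (𝓡 n) x) with hs | hs
  · rw [Subsingleton.elim (mlieBracket (𝓡 n) X Y x) 0, Subsingleton.elim (X x) 0,
      Subsingleton.elim (Y x) 0]
    simp
  · obtain ⟨z, hz⟩ := exists_ne (0 : TangentSpace (𝓡 n) x)
    let Z := extend (EuclideanSpace ℝ (Fin n)) z
    have hZ : ContMDiffAt (𝓡 n) (𝓡 n).tangent ∞ (T% Z) x := contMDiffAt_extend _ _ z
    have hZz : Z x = z := by simp [Z]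
    have e1 := leibniz_identity_mlieBracket_apply (hX.of_le h2) (hY.of_le h2) (hZ.of_le h2)
    have e2 := leibniz_identity_mlieBracket_apply (hX.of_le h2) (hY.of_le h2)
      ((hf.smul_section hZ).of_le h2)
    rw [mlieBracket_smul_comm hf hY hZ hYf, mlieBracket_smul_comm hf hX hZ hXf,
      mlieBracket_smul_right (hf.mdifferentiableAt (by simp)) (hZ.mdifferentiableAt (by simp)),
      e1, hZz] at e2
    have e3 : (mvfderiv (𝓡 n) (fun y ↦ mvfderiv (𝓡 n) f y (Y y)) x (X x) -
      mvfderiv (𝓡 n) (fun y ↦ mvfderiv (𝓡 n) f y (X y)) x (Y x) -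
      mvfderiv (𝓡 n) f x (mlieBracket (𝓡 n) X Y x)) • z = 0 := by
      rw [← sub_eq_zero] at e2
      rw [← e2]
      module
    rcases smul_eq_zero.1 e3 with h | h
    · linarith
    · exact absurd h hz

/-! ### Parallel bilinear forms and curvature -/

/-- Fields of bilinear forms on tangent spaces. -/
abbrev FormField (n : ℕ) (M : Type*) [TopologicalSpace M]
    [ChartedSpace (EuclideanSpace ℝ (Fin n)) M] : Type _ :=
  Π x : M, TangentSpace (𝓡 n) x →L[ℝ] TangentSpace (𝓡 n) x →L[ℝ] ℝ

/-- `B` is a smooth field of bilinear forms on `U` with `∇ B = 0`. -/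
structure IsParallelOn (cov : Connection n M) (B : FormField n M) (U : Set M) : Prop where
  smooth : ContMDiffOn (𝓡 n) ((𝓡 n).prod
      𝓘(ℝ, EuclideanSpace ℝ (Fin n) →L[ℝ] EuclideanSpace ℝ (Fin n) →L[ℝ] ℝ)) ∞
    (fun x ↦ TotalSpace.mk' (EuclideanSpace ℝ (Fin n) →L[ℝ] EuclideanSpace ℝ (Fin n) →L[ℝ] ℝ)
      (E := fun x : M ↦ TangentSpace (𝓡 n) x →L[ℝ] TangentSpace (𝓡 n) x →L[ℝ] ℝ) x (B x)) U
  deriv : ∀ x ∈ U, ∀ σ τ : Π x : M, TangentSpace (𝓡 n) x,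
    MDifferentiableAt (𝓡 n) (𝓡 n).tangent (T% σ) x →
    MDifferentiableAt (𝓡 n) (𝓡 n).tangent (T% τ) x → ∀ v : TangentSpace (𝓡 n) x,
      mvfderiv (𝓡 n) (fun y ↦ B y (σ y) (τ y)) x v =
        B x (cov σ x v) (τ x) + B x (σ x) (cov τ x v)

theorem FormField.contMDiffAt_apply {B : FormField n M} {x : M}
    (hB : ContMDiffAt (𝓡 n) ((𝓡 n).prod
        𝓘(ℝ, EuclideanSpace ℝ (Fin n) →L[ℝ] EuclideanSpace ℝ (Fin n) →L[ℝ] ℝ)) ∞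
      (fun x ↦ TotalSpace.mk' (EuclideanSpace ℝ (Fin n) →L[ℝ] EuclideanSpace ℝ (Fin n) →L[ℝ] ℝ)
        (E := fun x : M ↦ TangentSpace (𝓡 n) x →L[ℝ] TangentSpace (𝓡 n) x →L[ℝ] ℝ) x (B x)) x)
    {σ τ : Π x : M, TangentSpace (𝓡 n) x}
    (hσ : ContMDiffAt (𝓡 n) (𝓡 n).tangent ∞ (T% σ) x)
    (hτ : ContMDiffAt (𝓡 n) (𝓡 n).tangent ∞ (T% τ) x) :
    ContMDiffAt (𝓡 n) 𝓘(ℝ) ∞ (fun y ↦ B y (σ y) (τ y)) x := by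
  have : ContMDiffAt (𝓡 n) ((𝓡 n).prod 𝓘(ℝ)) ∞
      (fun m ↦ TotalSpace.mk' ℝ (E := Bundle.Trivial M ℝ) m (B m (σ m) (τ m))) x :=
    ContMDiffAt.clm_bundle_apply₂ (F₁ := EuclideanSpace ℝ (Fin n))
      (F₂ := EuclideanSpace ℝ (Fin n)) hB hσ hτ
  simp only [contMDiffAt_totalSpace] at this
  exact this.2

theorem FormField.mdifferentiableAt_apply {B : FormField n M} {x : M}
    (hB : ContMDiffAt (𝓡 n) ((𝓡 n).prod
        𝓘(ℝ, EuclideanSpace ℝ (Fin n) →L[ℝ] EuclideanSpace ℝ (Fin n) →L[ℝ] ℝ)) ∞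
      (fun x ↦ TotalSpace.mk' (EuclideanSpace ℝ (Fin n) →L[ℝ] EuclideanSpace ℝ (Fin n) →L[ℝ] ℝ)
        (E := fun x : M ↦ TangentSpace (𝓡 n) x →L[ℝ] TangentSpace (𝓡 n) x →L[ℝ] ℝ) x (B x)) x)
    {σ τ : Π x : M, TangentSpace (𝓡 n) x}
    (hσ : MDifferentiableAt (𝓡 n) (𝓡 n).tangent (T% σ) x)
    (hτ : MDifferentiableAt (𝓡 n) (𝓡 n).tangent (T% τ) x) :
    MDifferentiableAt (𝓡 n) 𝓘(ℝ) (fun y ↦ B y (σ y) (τ y)) x := by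
  have : MDifferentiableAt (𝓡 n) ((𝓡 n).prod 𝓘(ℝ))
      (fun m ↦ TotalSpace.mk' ℝ (E := Bundle.Trivial M ℝ) m (B m (σ m) (τ m))) x :=
    MDifferentiableAt.clm_bundle_apply₂ (F₁ := EuclideanSpace ℝ (Fin n))
      (F₂ := EuclideanSpace ℝ (Fin n)) (hB.mdifferentiableAt (by simp)) hσ hτ
  simp only [mdifferentiableAt_totalSpace] at this
  exact this.2

/-- The second derivative of `B(V, W)` for a parallel form `B`. -/
theorem IsParallelOn.mvfderiv_mvfderiv [T2Space M] {cov : Connection n M}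
    [cov.ContMDiffCovariantDerivative ∞] {B : FormField n M} {U : Set M}
    (hB : IsParallelOn cov B U) (hU : IsOpen U) {x : M} (hx : x ∈ U)
    (v w η : TangentSpace (𝓡 n) x) {V W Y : Π x : M, TangentSpace (𝓡 n) x}
    (hV : V = extend (EuclideanSpace ℝ (Fin n)) v) (hW : W = extend (EuclideanSpace ℝ (Fin n)) w)
    (hY : Y = extend (EuclideanSpace ℝ (Fin n)) η) :
    MDifferentiableAt (𝓡 n) 𝓘(ℝ)
        (fun y ↦ mvfderiv (𝓡 n) (fun z ↦ B z (V z) (W z)) y (Y y)) x ∧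
      ∀ ξ, mvfderiv (𝓡 n) (fun y ↦ mvfderiv (𝓡 n) (fun z ↦ B z (V z) (W z)) y (Y y)) x ξ =
        B x (cov (fun y ↦ cov V y (Y y)) x ξ) w + B x (cov V x η) (cov W x ξ) +
        (B x (cov V x ξ) (cov W x η) + B x v (cov (fun y ↦ cov W y (Y y)) x ξ)) := by
  have hBx := hB.smooth.contMDiffAt (hU.mem_nhds hx)
  have hVx : MDifferentiableAt (𝓡 n) (𝓡 n).tangent (T% V) x := hV ▸ mdifferentiableAt_extend _ _ v
  have hWx : MDifferentiableAt (𝓡 n) (𝓡 n).tangent (T% W) x := hW ▸ mdifferentiableAt_extend _ _ w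
  have hYV : MDifferentiableAt (𝓡 n) (𝓡 n).tangent (T% (fun y ↦ cov V y (Y y))) x := by
    rw [hV, hY]; exact mdifferentiableAt_cov_extend cov v η
  have hYW : MDifferentiableAt (𝓡 n) (𝓡 n).tangent (T% (fun y ↦ cov W y (Y y))) x := by
    rw [hW, hY]; exact mdifferentiableAt_cov_extend cov w η
  -- Parallelism holds on a whole neighbourhood, so the first derivative is a sum of two functions
  -- to which it applies again.
  have hev : (fun y ↦ mvfderiv (𝓡 n) (fun z ↦ B z (V z) (W z)) y (Y y)) =ᶠ[𝓝 x]
      fun y ↦ B y (cov V y (Y y)) (W y) + B y (V y) (cov W y (Y y)) := by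
    filter_upwards [hU.mem_nhds hx, mdifferentiable_extend_eventually v,
      mdifferentiable_extend_eventually w] with y hy hv hw
    exact hB.deriv y hy V W (hV ▸ hv) (hW ▸ hw) (Y y)
  have h1 := FormField.mdifferentiableAt_apply hBx hYV hWx
  have h2 := FormField.mdifferentiableAt_apply hBx hVx hYW
  refine ⟨(h1.add h2).congr_of_eventuallyEq hev, fun ξ ↦ ?_⟩
  have : mvfderiv (𝓡 n) (fun y ↦ mvfderiv (𝓡 n) (fun z ↦ B z (V z) (W z)) y (Y y)) x =
      mvfderiv (𝓡 n) (fun y ↦ B y (cov V y (Y y)) (W y) + B y (V y) (cov W y (Y y))) x :=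
    hev.mvfderiv_eq
  rw [this, mvfderiv_fun_add h1 h2, add_apply, hB.deriv x hx _ _ hYV hWx,
    hB.deriv x hx _ _ hVx hYW]
  simp [hV, hW, hY]

/-- Curvature operators are skew with respect to parallel forms. -/
theorem IsParallelOn.curvature_skew [T2Space M] {cov : Connection n M}
    [cov.ContMDiffCovariantDerivative ∞] {B : FormField n M} {U : Set M}
    (hB : IsParallelOn cov B U) (hU : IsOpen U) {x : M} (hx : x ∈ U)
    (ξ η v w : TangentSpace (𝓡 n) x) :
    B x (curvature cov ξ η v) w + B x v (curvature cov ξ η w) = 0 := by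
  obtain ⟨d1, e1⟩ := hB.mvfderiv_mvfderiv hU hx v w ξ rfl rfl rfl
  obtain ⟨d2, e2⟩ := hB.mvfderiv_mvfderiv hU hx v w η rfl rfl rfl
  have hv := contMDiffAt_extend (k := ∞) (𝓡 n) (EuclideanSpace ℝ (Fin n)) v
  have hw := contMDiffAt_extend (k := ∞) (𝓡 n) (EuclideanSpace ℝ (Fin n)) w
  have hBx := hB.smooth.contMDiffAt (hU.mem_nhds hx)
  -- The terms pairing a first derivative of V with one of W are symmetric under exchanging ξ and η,
  -- so they drop out of the commutator.
  have := mvfderiv_mlieBracket (FormField.contMDiffAt_apply hBx hv hw)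
    (contMDiffAt_extend (k := ∞) (𝓡 n) (EuclideanSpace ℝ (Fin n)) ξ)
    (contMDiffAt_extend (k := ∞) (𝓡 n) (EuclideanSpace ℝ (Fin n)) η) d1 d2
  rw [hB.deriv x hx _ _ (hv.mdifferentiableAt (by simp)) (hw.mdifferentiableAt (by simp)),
    extend_apply_self, extend_apply_self, e1, e2, extend_apply_self, extend_apply_self] at this
  change B x (curvatureField _ _ _ _ _) w + B x v (curvatureField _ _ _ _ _) = 0
  simp only [curvatureField, map_sub, sub_apply, extend_apply_self]
  linarith

/-! ### Linear algebra of skew operators with distinct eigenvalues -/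

section PlaneRotations

variable {W : Type*} [AddCommGroup W] [Module ℝ W]

theorem one_tmul_add_I_tmul_inj {u v u' v' : W}
    (h : (1 : ℂ) ⊗ₜ[ℝ] u + Complex.I ⊗ₜ[ℝ] v = (1 : ℂ) ⊗ₜ[ℝ] u' + Complex.I ⊗ₜ[ℝ] v') :
    u = u' ∧ v = v' := by
  have hre := congrArg (TensorProduct.lid ℝ W ∘ LinearMap.rTensor W Complex.reLm) h
  have him := congrArg (TensorProduct.lid ℝ W ∘ LinearMap.rTensor W Complex.imLm) h
  simp at hre him
  exact ⟨hre, him⟩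

theorem complex_smul_tmul (μ : ℂ) (u v : W) :
    μ • ((1 : ℂ) ⊗ₜ[ℝ] u + Complex.I ⊗ₜ[ℝ] v) =
      (1 : ℂ) ⊗ₜ[ℝ] (μ.re • u - μ.im • v) + Complex.I ⊗ₜ[ℝ] (μ.im • u + μ.re • v) := by
  have h1 (c : ℝ) (w : W) : (1 : ℂ) ⊗ₜ[ℝ] (c • w) = (c : ℂ) ⊗ₜ[ℝ] w := by
    rw [TensorProduct.tmul_smul, TensorProduct.smul_tmul']; simp
  have hI (c : ℝ) (w : W) : Complex.I ⊗ₜ[ℝ] (c • w) = (c * Complex.I : ℂ) ⊗ₜ[ℝ] w := by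
    rw [TensorProduct.tmul_smul, TensorProduct.smul_tmul']; simp
  have e1 : μ = (μ.re : ℂ) + (μ.im * Complex.I : ℂ) := (Complex.re_add_im μ).symm
  have e2 : μ * Complex.I = (μ.re * Complex.I : ℂ) - (μ.im : ℂ) := by
    conv_lhs => rw [e1]
    linear_combination (μ.im : ℂ) * Complex.I_mul_I
  rw [smul_add, TensorProduct.smul_tmul', TensorProduct.smul_tmul', smul_eq_mul, smul_eq_mul,
    mul_one, TensorProduct.tmul_sub, TensorProduct.tmul_add, h1, h1, hI, hI, e2]
  conv_lhs => rw [e1, TensorProduct.add_tmul, TensorProduct.sub_tmul]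
  simp only [Complex.add_re, Complex.ofReal_re, Complex.mul_re, Complex.I_re, Complex.ofReal_im,
    Complex.I_im, Complex.add_im, Complex.mul_im]
  simp
  abel

theorem apply_eq_of_baseChange_eigen {R : W →ₗ[ℝ] W} {μ : ℂ} {u v : W}
    (h : R.baseChange ℂ ((1 : ℂ) ⊗ₜ[ℝ] u + Complex.I ⊗ₜ[ℝ] v) =
      μ • ((1 : ℂ) ⊗ₜ[ℝ] u + Complex.I ⊗ₜ[ℝ] v)) :
    R u = μ.re • u - μ.im • v ∧ R v = μ.im • u + μ.re • v := by
  rw [complex_smul_tmul, map_add, LinearMap.baseChange_tmul, LinearMap.baseChange_tmul] at h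
  exact one_tmul_add_I_tmul_inj h

/-- If `R` is skew for an inner product and has the vectors of the complex frame of `X` as
eigenvectors, with distinct eigenvalues, then it rotates the planes of `X` with distinct speeds. -/
theorem exists_rotation_speeds {R : W →ₗ[ℝ] W} {X : FrameIdx n → W} {μ : FrameIdx n → ℂ}
    (hμ : Function.Injective μ)
    (hR : ∀ i, R.baseChange ℂ (complexFrame X i) = μ i • complexFrame X i)
    (hX : ∀ i, X i ≠ 0) {B : W →ₗ[ℝ] W →ₗ[ℝ] ℝ} (hsymm : ∀ v w, B v w = B w v)
    (hpos : ∀ v, v ≠ 0 → 0 < B v v) (hskew : ∀ v w, B (R v) w + B v (R w) = 0) :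
    ∃ b : Fin (n / 2) → ℝ, (∀ k, b k ≠ 0) ∧ (∀ k l, k ≠ l → b k ^ 2 ≠ b l ^ 2) ∧
      (∀ k, R (X (.inl (k, 0))) = -b k • X (.inl (k, 1))) ∧
      (∀ k, R (X (.inl (k, 1))) = b k • X (.inl (k, 0))) ∧ ∀ r, R (X (.inr r)) = 0 := by
  have hz (v) : B (R v) v = 0 := by linarith [hskew v v, hsymm v (R v)]
  have key (μ : ℂ) (u v : W) (hu : u ≠ 0) (h1 : R u = μ.re • u - μ.im • v)
      (h2 : R v = μ.im • u + μ.re • v) : μ.re = 0 := by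
    have e1 := hz u
    have e2 := hz v
    rw [h1] at e1
    rw [h2] at e2
    simp only [map_sub, map_add, map_smul, LinearMap.sub_apply, LinearMap.add_apply,
      LinearMap.smul_apply, smul_eq_mul] at e1 e2
    have hp := hpos u hu
    have hv : 0 ≤ B v v := by
      by_cases hv : v = 0
      · simp [hv]
      · exact (hpos v hv).le
    -- Sum of B(Ru, u) = 0 and B(Rv, v) = 0; the terms with the imaginary part cancel by symmetry.
    have : μ.re * (B u u + B v v) = 0 := by linear_combination e1 + e2 - μ.im * hsymm u v
    rcases mul_eq_zero.1 this with h | h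
    · exact h
    · linarith
  have h0 (k) := apply_eq_of_baseChange_eigen (hR (.inl (k, 0)))
  have h1 (k) : R (X (.inl (k, 0))) =
        (μ (.inl (k, 1))).re • X (.inl (k, 0)) + (μ (.inl (k, 1))).im • X (.inl (k, 1)) ∧
      R (X (.inl (k, 1))) =
        (μ (.inl (k, 1))).re • X (.inl (k, 1)) - (μ (.inl (k, 1))).im • X (.inl (k, 0)) := by
    have := hR (.inl (k, 1))
    rw [complexFrame, sub_eq_add_neg, ← TensorProduct.tmul_neg] at this
    obtain ⟨e1, e2⟩ := apply_eq_of_baseChange_eigen this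
    refine ⟨by rw [e1]; module, ?_⟩
    rw [map_neg, neg_eq_iff_eq_neg] at e2
    rw [e2]; module
  have hre0 (k) : (μ (.inl (k, 0))).re = 0 := key _ _ _ (hX _) (h0 k).1 (h0 k).2
  have hre1 (k) : (μ (.inl (k, 1))).re = 0 :=
    key _ (X (.inl (k, 0))) (-X (.inl (k, 1))) (hX _) (by rw [(h1 k).1]; module)
      (by rw [map_neg, (h1 k).2]; module)
  -- Both conjugate eigenvectors compute R on the first vector of the plane; the coefficients of the
  -- second are compared.
  have him (k) : (μ (.inl (k, 1))).im = -(μ (.inl (k, 0))).im := by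
    have := (h0 k).1.symm.trans (h1 k).1
    simp only [hre0, hre1] at this
    replace this : -((μ (.inl (k, 0))).im • X (.inl (k, 1))) =
        (μ (.inl (k, 1))).im • X (.inl (k, 1)) := by simpa using this
    have h3 : ((μ (.inl (k, 1))).im + (μ (.inl (k, 0))).im) • X (.inl (k, 1)) = 0 := by
      rw [add_smul, ← this]; simp
    rcases smul_eq_zero.1 h3 with h | h
    · linarith
    · exact absurd h (hX _)
  refine ⟨fun k ↦ (μ (.inl (k, 0))).im, fun k hk ↦ ?_, fun k l hkl hb ↦ ?_, fun k ↦ ?_,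
    fun k ↦ ?_, fun r ↦ ?_⟩
  -- Speed 0 would make the two eigenvalues of the plane coincide.
  · dsimp only at hk
    have : μ (.inl (k, 0)) = μ (.inl (k, 1)) :=
      Complex.ext (by rw [hre0, hre1]) (by rw [him, hk, neg_zero])
    simpa using hμ this
  · dsimp only at hb
    rcases sq_eq_sq_iff_eq_or_eq_neg.1 hb with h | h
    · have : μ (.inl (k, 0)) = μ (.inl (l, 0)) := Complex.ext (by rw [hre0, hre0]) h
      exact hkl (by simpa using hμ this)
    · have : μ (.inl (k, 0)) = μ (.inl (l, 1)) := Complex.ext (by rw [hre0, hre1]) (by rw [h, him])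
      simpa using hμ this
  · rw [(h0 k).1, hre0]; module
  · rw [(h0 k).2, hre0]; module
  -- The unpaired real vector is the case of zero imaginary part, with purely imaginary eigenvalue;
  -- the imaginary part multiplies v = 0.
  · have hr : R.baseChange ℂ ((1 : ℂ) ⊗ₜ[ℝ] X (.inr r) + Complex.I ⊗ₜ[ℝ] 0) =
        μ (.inr r) • ((1 : ℂ) ⊗ₜ[ℝ] X (.inr r) + Complex.I ⊗ₜ[ℝ] 0) := by
      simpa [complexFrame] using hR (.inr r)
    obtain ⟨e1, e2⟩ := apply_eq_of_baseChange_eigen hr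
    rw [e1, key _ _ _ (hX _) e1 e2]
    simp

/-- A symmetric form for which `R` is skew is diagonal in a frame whose planes are rotated by `R`
with distinct speeds. -/
theorem diagonal_of_skew {R : W →ₗ[ℝ] W} {X : FrameIdx n → W} {b : Fin (n / 2) → ℝ}
    (hb : ∀ k, b k ≠ 0) (hbb : ∀ k l, k ≠ l → b k ^ 2 ≠ b l ^ 2)
    (h0 : ∀ k, R (X (.inl (k, 0))) = -b k • X (.inl (k, 1)))
    (h1 : ∀ k, R (X (.inl (k, 1))) = b k • X (.inl (k, 0))) (h2 : ∀ r, R (X (.inr r)) = 0)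
    {B : W →ₗ[ℝ] W →ₗ[ℝ] ℝ} (hsymm : ∀ v w, B v w = B w v)
    (hskew : ∀ v w, B (R v) w + B v (R w) = 0) :
    ∀ i j, i ≠ j → B (X i) (X j) = 0 := by
  -- The X i are eigenvectors of R² with eigenvalue -s i. By skewness used twice, R² is self-adjoint
  -- for B, so different values of s give B-orthogonal vectors.
  let s : FrameIdx n → ℝ := Sum.elim (fun k ↦ b k.1 ^ 2) 0
  have hs (i) : R (R (X i)) = -s i • X i := by
    rcases i with ⟨k, c⟩ | r
    · fin_cases c
      · simp only [Fin.zero_eta, h0, map_smul, h1, s, Sum.elim_inl]; module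
      · simp only [Fin.mk_one, h0, map_smul, h1, s, Sum.elim_inl]; module
    · simp [h2, s]
  have hoff (i j) (hij : s i ≠ s j) : B (X i) (X j) = 0 := by
    have e := hskew (R (X i)) (X j)
    have e' := hskew (X i) (R (X j))
    rw [hs] at e e'
    simp only [map_smul, LinearMap.smul_apply, smul_eq_mul] at e e'
    have : (s i - s j) * B (X i) (X j) = 0 := by linear_combination -e + e'
    rcases mul_eq_zero.1 this with h | h
    · exact absurd (sub_eq_zero.1 h) hij
    · exact h
  -- R² does not separate the two vectors of one plane; skewness of R itself does, since R sends one
  -- to a nonzero multiple of the other.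
  have hpair (k) : B (X (.inl (k, 1))) (X (.inl (k, 0))) = 0 := by
    have e := hskew (X (.inl (k, 0))) (X (.inl (k, 0)))
    rw [h0, hsymm (X (.inl (k, 0)))] at e
    simp only [map_smul, LinearMap.smul_apply, smul_eq_mul] at e
    have : b k * B (X (.inl (k, 1))) (X (.inl (k, 0))) = 0 := by linarith
    exact (mul_eq_zero.1 this).resolve_left (hb k)
  intro i j hij
  rcases i with ⟨k, c⟩ | r <;> rcases j with ⟨l, d⟩ | t
  · by_cases hkl : k = l
    · subst hkl
      fin_cases c <;> fin_cases d
      · exact absurd rfl hij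
      · exact (hsymm _ _).trans (hpair k)
      · exact hpair k
      · exact absurd rfl hij
    · exact hoff _ _ (hbb k l hkl)
  · exact hoff _ _ (pow_ne_zero 2 (hb k))
  · exact hoff _ _ (pow_ne_zero 2 (hb l)).symm
  -- There is at most one unpaired index.
  · exact absurd (congrArg Sum.inr (Fin.ext (by omega))) hij

end PlaneRotations

/-- The square of a smooth covector field is a smooth field of bilinear forms. -/
theorem contMDiffAt_smulRight_self {α : Π x : M, TangentSpace (𝓡 n) x →L[ℝ] ℝ} {x : M}
    (hα : ContMDiffAt (𝓡 n) ((𝓡 n).prod 𝓘(ℝ, EuclideanSpace ℝ (Fin n) →L[ℝ] ℝ)) ∞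
      (fun x ↦ TotalSpace.mk' (EuclideanSpace ℝ (Fin n) →L[ℝ] ℝ)
        (E := fun x : M ↦ TangentSpace (𝓡 n) x →L[ℝ] Bundle.Trivial M ℝ x) x (α x)) x) :
    ContMDiffAt (𝓡 n) ((𝓡 n).prod
        𝓘(ℝ, EuclideanSpace ℝ (Fin n) →L[ℝ] EuclideanSpace ℝ (Fin n) →L[ℝ] ℝ)) ∞
      (fun x ↦ TotalSpace.mk' (EuclideanSpace ℝ (Fin n) →L[ℝ] EuclideanSpace ℝ (Fin n) →L[ℝ] ℝ)
        (E := fun x : M ↦ TangentSpace (𝓡 n) x →L[ℝ] TangentSpace (𝓡 n) x →L[ℝ] ℝ) x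
        ((α x).smulRight (α x))) x := by
  have h1 := ((contMDiffAt_hom_bundle _).1 hα).2
  refine (contMDiffAt_hom_bundle _).2 ⟨contMDiffAt_id, ?_⟩
  -- In the trivialization at x the field is the smooth map β ↦ β ⊗ β applied to the coordinates of
  -- α.
  have h2 : ContMDiffAt (𝓡 n)
      𝓘(ℝ, EuclideanSpace ℝ (Fin n) →L[ℝ] EuclideanSpace ℝ (Fin n) →L[ℝ] ℝ) ∞
      (fun y ↦ (ContinuousLinearMap.inCoordinates (EuclideanSpace ℝ (Fin n))
          (fun x : M ↦ TangentSpace (𝓡 n) x) ℝ (Bundle.Trivial M ℝ) x y x y (α y)).smulRight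
        (ContinuousLinearMap.inCoordinates (EuclideanSpace ℝ (Fin n))
          (fun x : M ↦ TangentSpace (𝓡 n) x) ℝ (Bundle.Trivial M ℝ) x y x y (α y))) x :=
    ContDiffAt.comp_contMDiffAt (g := fun β : EuclideanSpace ℝ (Fin n) →L[ℝ] ℝ ↦ β.smulRight β)
      (contDiffAt_id.smulRight contDiffAt_id) h1
  refine h2.congr_of_eventuallyEq ?_
  filter_upwards [(trivializationAt (EuclideanSpace ℝ (Fin n))
    (fun x : M ↦ TangentSpace (𝓡 n) x) x).open_baseSet.mem_nhds
      (FiberBundle.mem_baseSet_trivializationAt' x)] with y hy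
  ext v w
  rw [inCoordinates_apply_eq₂ hy hy (mem_univ _)]
  simp [ContinuousLinearMap.inCoordinates, Trivialization.symmL_apply _ hy]

theorem IsParallel.isParallelOn {cov : Connection n M} {g : Metric n M} (hg : IsParallel cov g)
    (U : Set M) : IsParallelOn cov g.inner U where
  smooth := g.contMDiff.contMDiffOn
  deriv x _ σ τ hσ hτ v := by
    have := (isParallel_iff cov g).1 hg (X := extend (EuclideanSpace ℝ (Fin n)) v)
      (mdifferentiableAt_extend _ _ v) hσ hτ
    simpa using this

theorem isParallel_of_isParallelOn {cov : Connection n M} {g : Metric n M}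
    (hg : ∀ x, ∃ U, x ∈ U ∧ IsParallelOn cov g.inner U) : IsParallel cov g := by
  refine (isParallel_iff cov g).2 fun {x X σ τ} _ hσ hτ ↦ ?_
  obtain ⟨U, hx, hU⟩ := hg x
  exact hU.deriv x hx σ τ hσ hτ (X x)

/-! ### Eigenframes: orthonormality and connection forms -/

namespace EigenFrame

variable [T2Space M] {cov : Connection n M} [cov.ContMDiffCovariantDerivative ∞] {U : Set M}
  (F : EigenFrame cov U) {h : Metric n M}

theorem contMDiffAt_X (hU : IsOpen U) {x : M} (hx : x ∈ U) (i : FrameIdx n) :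
    ContMDiffAt (𝓡 n) (𝓡 n).tangent ∞ (T% (F.X i)) x :=
  F.isFrame.contMDiffAt hU hx i

theorem X_ne_zero {x : M} (hx : x ∈ U) (i : FrameIdx n) : F.X i x ≠ 0 :=
  (F.isFrame.linearIndependent hx).ne_zero i

theorem contMDiffAt_Y (h : Metric n M) (hU : IsOpen U) {x : M} (hx : x ∈ U) (i : FrameIdx n) :
    ContMDiffAt (𝓡 n) (𝓡 n).tangent ∞ (T% (F.Y h i)) x := by
  have h1 : ContMDiffAt (𝓡 n) 𝓘(ℝ) ∞ (fun x ↦ h.inner x (F.X i x) (F.X i x)) x :=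
    FormField.contMDiffAt_apply h.contMDiff.contMDiffAt (F.contMDiffAt_X hU hx i)
      (F.contMDiffAt_X hU hx i)
  have hp := h.pos x _ (F.X_ne_zero hx i)
  have h2 : ContMDiffAt (𝓡 n) 𝓘(ℝ) ∞
      (fun x ↦ (Real.sqrt (h.inner x (F.X i x) (F.X i x)))⁻¹) x :=
    ContDiffAt.comp_contMDiffAt (g := fun t : ℝ ↦ (Real.sqrt t)⁻¹)
      ((Real.contDiffAt_sqrt hp.ne').inv (Real.sqrt_pos.2 hp).ne') h1
  exact h2.smul_section (F.contMDiffAt_X hU hx i)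

theorem mdifferentiableAt_Y (h : Metric n M) (hU : IsOpen U) {x : M} (hx : x ∈ U)
    (i : FrameIdx n) : MDifferentiableAt (𝓡 n) (𝓡 n).tangent (T% (F.Y h i)) x :=
  (F.contMDiffAt_Y h hU hx i).mdifferentiableAt (by simp)

/-- Parallel symmetric forms are diagonal in an eigenframe. -/
theorem apply_X_X_eq_zero (hh : IsParallel cov h) {B : FormField n M} {V : Set M} (hV : IsOpen V)
    (hB : IsParallelOn cov B V) (hsymm : ∀ x v w, B x v w = B x w v) {x : M} (hxU : x ∈ U)
    (hxV : x ∈ V) {i j : FrameIdx n} (hij : i ≠ j) : B x (F.X i x) (F.X j x) = 0 := by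
  have hR := (hh.isParallelOn univ).curvature_skew isOpen_univ (mem_univ x) (F.ξ₁ x) (F.ξ₂ x)
  have hR' := hB.curvature_skew hV hxV (F.ξ₁ x) (F.ξ₂ x)
  have he := F.eigen x hxU
  -- From here on only skewness of R for h and B and its eigenvectors matter.
  generalize curvature cov (F.ξ₁ x) (F.ξ₂ x) = R at hR hR' he
  obtain ⟨b, hb, hbb, h0, h1, h2⟩ := exists_rotation_speeds (F.distinct x hxU) he
    (F.X_ne_zero hxU) (B := (h.inner x).toLinearMap₁₂) (h.symm x) (h.pos x) hR
  exact diagonal_of_skew (X := (F.X · x)) hb hbb h0 h1 h2 (B := (B x).toLinearMap₁₂) (hsymm x) hR' i j hij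

theorem apply_Y_Y_eq_zero (hh : IsParallel cov h) {B : FormField n M} {V : Set M} (hV : IsOpen V)
    (hB : IsParallelOn cov B V) (hsymm : ∀ x v w, B x v w = B x w v) {x : M} (hxU : x ∈ U)
    (hxV : x ∈ V) {i j : FrameIdx n} (hij : i ≠ j) : B x (F.Y h i x) (F.Y h j x) = 0 := by
  simp [Y, F.apply_X_X_eq_zero hh hV hB hsymm hxU hxV hij]

-- Off the diagonal, h is itself a parallel symmetric form, hence diagonal in its eigenframes.
open Classical in
theorem inner_Y_Y (hh : IsParallel cov h) {x : M} (hx : x ∈ U) (i j : FrameIdx n) :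
    h.inner x (F.Y h i x) (F.Y h j x) = if i = j then 1 else 0 := by
  split_ifs with hij
  · subst hij
    have hp := h.pos x _ (F.X_ne_zero hx i)
    simp only [Y, map_smul, smul_apply, smul_eq_mul]
    rw [← mul_assoc, ← mul_inv, Real.mul_self_sqrt hp.le, inv_mul_cancel₀ hp.ne']
  · exact F.apply_Y_Y_eq_zero hh isOpen_univ (hh.isParallelOn univ) h.symm hx (mem_univ x) hij

theorem Y_ne_zero {x : M} (hx : x ∈ U) (i : FrameIdx n) : F.Y h i x ≠ 0 := by
  rw [← F.basisY_apply h hx]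
  exact (F.basisY h hx).ne_zero i

theorem sum_inner_smul_Y (hh : IsParallel cov h) {x : M} (hx : x ∈ U)
    (v : TangentSpace (𝓡 n) x) : ∑ j, h.inner x (F.Y h j x) v • F.Y h j x = v := by
  classical
  have key : ∀ j, h.inner x (F.Y h j x) v = (F.basisY h hx).repr v j := fun j ↦ by
    conv_lhs => rw [← (F.basisY h hx).sum_repr v]
    simp [F.basisY_apply h hx, F.inner_Y_Y hh hx, -Fintype.sum_sum_type]
  conv_rhs => rw [← (F.basisY h hx).sum_repr v]
  simp [key, F.basisY_apply h hx]

theorem connectionForm_eq_inner (hh : IsParallel cov h) {x : M} (hx : x ∈ U) (i j : FrameIdx n)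
    (v : TangentSpace (𝓡 n) x) :
    F.connectionForm h hx i j v = h.inner x (F.Y h i x) (cov (F.Y h j) x v) := by
  classical
  change (F.basisY h hx).repr (cov (F.Y h j) x v) i = _
  conv_rhs => rw [← (F.basisY h hx).sum_repr (cov (F.Y h j) x v)]
  simp [F.basisY_apply h hx, F.inner_Y_Y hh hx, -Fintype.sum_sum_type]

/-- Differentiate the constants h(Y_i, Y_j). -/
theorem connectionForm_antisymm (hh : IsParallel cov h) (hU : IsOpen U) {x : M} (hx : x ∈ U)
    (i j : FrameIdx n) (v : TangentSpace (𝓡 n) x) :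
    F.connectionForm h hx i j v = -F.connectionForm h hx j i v := by
  classical
  have hc : (fun y ↦ h.inner y (F.Y h i y) (F.Y h j y)) =ᶠ[𝓝 x]
      fun _ ↦ if i = j then (1 : ℝ) else 0 := by
    filter_upwards [hU.mem_nhds hx] with y hy using F.inner_Y_Y hh hy i j
  have := (hh.isParallelOn univ).deriv x (mem_univ x) _ _ (F.mdifferentiableAt_Y h hU hx i)
    (F.mdifferentiableAt_Y h hU hx j) v
  rw [hc.mvfderiv_eq, mvfderiv_const, zero_apply, h.symm x (cov _ _ _),
    ← F.connectionForm_eq_inner hh hx, ← F.connectionForm_eq_inner hh hx] at this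
  linarith

theorem cov_Y (h : Metric n M) {x : M} (hx : x ∈ U) (j : FrameIdx n) (v : TangentSpace (𝓡 n) x) :
    cov (F.Y h j) x v = ∑ i, F.connectionForm h hx i j v • F.Y h i x := by
  conv_lhs => rw [← (F.basisY h hx).sum_repr (cov (F.Y h j) x v)]
  simp [F.basisY_apply h hx, connectionForm]

end EigenFrame

/-- On a ball in a chart the derivative vanishes, so f is locally constant; preconnectedness does
the rest. -/
theorem eq_of_mvfderiv_eq_zero {f : M → ℝ} {U : Set M} (hU : IsOpen U) (hc : IsPreconnected U)
    (hf : ∀ x ∈ U, MDifferentiableAt (𝓡 n) 𝓘(ℝ) f x) (hd : ∀ x ∈ U, mvfderiv (𝓡 n) f x = 0)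
    {x y : M} (hx : x ∈ U) (hy : y ∈ U) : f x = f y := by
  have hloc : ∀ z ∈ U, ∀ᶠ w in 𝓝 z, f w = f z := by
    intro z hz
    let φ := extChartAt (𝓡 n) z
    have hV : φ.target ∩ φ.symm ⁻¹' U ∈ 𝓝 (φ z) :=
      inter_mem (extChartAt_target_mem_nhds z) ((continuousAt_extChartAt_symm z).preimage_mem_nhds
        (by rw [extChartAt_to_inv]; exact hU.mem_nhds hz))
    obtain ⟨ε, hε, hball⟩ := Metric.mem_nhds_iff.1 hV
    have hder : ∀ u ∈ Metric.ball (φ z) ε, HasFDerivAt (f ∘ φ.symm)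
        (0 : EuclideanSpace ℝ (Fin n) →L[ℝ] ℝ) u := by
      intro u hu
      have h1 : HasMFDerivAt (𝓡 n) 𝓘(ℝ) f (φ.symm u) 0 := by
        have h2 := (hf _ (hball hu).2).hasMFDerivAt
        have h3 : mfderiv (𝓡 n) 𝓘(ℝ) f (φ.symm u) = 0 := by
          ext v
          exact congr($(hd _ (hball hu).2) v)
        rwa [h3] at h2
      have h4 : MDifferentiableAt 𝓘(ℝ, EuclideanSpace ℝ (Fin n)) (𝓡 n) φ.symm u :=
        ((contMDiffOn_extChartAt_symm (n := ∞) z).contMDiffAt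
          (extChartAt_target_mem_nhds' (hball hu).1)).mdifferentiableAt (by simp)
      have h5 := h1.comp u h4.hasMFDerivAt
      rw [ContinuousLinearMap.zero_comp] at h5
      exact h5.hasFDerivAt
    filter_upwards [extChartAt_source_mem_nhds (I := 𝓡 n) z,
      (continuousAt_extChartAt (I := 𝓡 n) z).preimage_mem_nhds (Metric.ball_mem_nhds _ hε)]
      with w hw hw'
    have h6 := Metric.isOpen_ball.is_const_of_fderiv_eq_zero
      (convex_ball (φ z) ε).isPreconnected
      (fun u hu ↦ (hder u hu).differentiableAt.differentiableWithinAt)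
      (fun u hu ↦ (hder u hu).fderiv) hw' (Metric.mem_ball_self hε)
    have h7 : f (φ.symm (φ w)) = f (φ.symm (φ z)) := h6
    rwa [φ.left_inv hw, extChartAt_to_inv] at h7
  have hA : IsOpen {z | z ∈ U ∧ f z = f x} := isOpen_iff_mem_nhds.2 fun z hz ↦ by
    filter_upwards [hU.mem_nhds hz.1, hloc z hz.1] with w hw hwz using ⟨hw, hwz.trans hz.2⟩
  have hB : IsOpen {z | z ∈ U ∧ f z ≠ f x} := isOpen_iff_mem_nhds.2 fun z hz ↦ by
    filter_upwards [hU.mem_nhds hz.1, hloc z hz.1] with w hw hwz using ⟨hw, hwz ▸ hz.2⟩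
  have hsub := hc.subset_left_of_subset_union hA hB
    (disjoint_left.2 fun z h1 h2 ↦ h2.2 h1.2)
    (fun z hz ↦ (em (f z = f x)).imp (fun h ↦ ⟨hz, h⟩) fun h ↦ ⟨hz, h⟩) ⟨x, hx, hx, rfl⟩
  exact (hsub hy).2.symm

theorem mvfderiv_fun_sum {ι : Type*} {N : Type*} [TopologicalSpace N]
    [ChartedSpace (EuclideanSpace ℝ (Fin n)) N] (s : Finset ι) {f : ι → N → ℝ} {x : N}
    (hf : ∀ i, MDifferentiableAt (𝓡 n) 𝓘(ℝ) (f i) x) :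
    MDifferentiableAt (𝓡 n) 𝓘(ℝ) (fun y ↦ ∑ i ∈ s, f i y) x ∧
      mvfderiv (𝓡 n) (fun y ↦ ∑ i ∈ s, f i y) x = ∑ i ∈ s, mvfderiv (𝓡 n) (f i) x := by
  classical
  induction s using Finset.induction_on with
  | empty => simpa using ⟨mdifferentiableAt_const, mvfderiv_const 0⟩
  | insert a s ha ih =>
    simp only [Finset.sum_insert ha]
    exact ⟨(hf a).add ih.1, by rw [mvfderiv_fun_add (hf a) ih.1, ih.2]⟩

/-! ### Local blocks and parallel forms -/

namespace EigenFrame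

variable [T2Space M] {cov : Connection n M} [cov.ContMDiffCovariantDerivative ∞] {U : Set M}
  (F : EigenFrame cov U) {h : Metric n M}

/-- `∑ j, d_j h(Y_j, ·) h(Y_j, ·)`, with coefficients constant on the blocks. -/
def blockForm (h : Metric n M) (d : F.LocalBlock h → ℝ) : FormField n M := fun x ↦
  ∑ j, d (Quotient.mk _ j) • (h.inner x (F.Y h j x)).smulRight (h.inner x (F.Y h j x))

theorem blockForm_apply (d : F.LocalBlock h → ℝ) (x : M) (v w : TangentSpace (𝓡 n) x) :
    F.blockForm h d x v w =
      ∑ j, d (Quotient.mk _ j) * (h.inner x (F.Y h j x) v * h.inner x (F.Y h j x) w) := by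
  simp [blockForm, sum_apply, smul_apply, -Fintype.sum_sum_type]

theorem contMDiffAt_blockForm (hU : IsOpen U) (d : F.LocalBlock h → ℝ) {x : M} (hx : x ∈ U) :
    ContMDiffAt (𝓡 n) ((𝓡 n).prod
        𝓘(ℝ, EuclideanSpace ℝ (Fin n) →L[ℝ] EuclideanSpace ℝ (Fin n) →L[ℝ] ℝ)) ∞
      (fun x ↦ TotalSpace.mk' (EuclideanSpace ℝ (Fin n) →L[ℝ] EuclideanSpace ℝ (Fin n) →L[ℝ] ℝ)
        (E := fun x : M ↦ TangentSpace (𝓡 n) x →L[ℝ] TangentSpace (𝓡 n) x →L[ℝ] ℝ) x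
        (F.blockForm h d x)) x := by
  have h1 (j) := contMDiffAt_smulRight_self (h.contMDiff.contMDiffAt.clm_bundle_apply
    (F₁ := EuclideanSpace ℝ (Fin n)) (F.contMDiffAt_Y h hU hx j))
  have (x : M) : ContinuousAdd (TangentSpace (𝓡 n) x →L[ℝ] ℝ) := inferInstance
  have h2 (j) := (h1 j).const_smul_section (a := d (Quotient.mk _ j))
  exact ContMDiffAt.sum_section (s := Finset.univ) fun j _ ↦ h2 j

/-- With θ_j = h(Y_j, ·), the covariant derivative is ∑ d_j ω^i_j (θ_j ⊗ θ_i + θ_i ⊗ θ_j). Where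
ω^i_j ≠ 0 the indices share a block and d_i = d_j, so an antisymmetric factor meets a symmetric one.
-/
theorem isParallelOn_blockForm (hh : IsParallel cov h) (hU : IsOpen U)
    (d : F.LocalBlock h → ℝ) : IsParallelOn cov (F.blockForm h d) U where
  smooth x hx := (F.contMDiffAt_blockForm hU d hx).contMDiffWithinAt
  deriv x hx σ τ hσ hτ v := by
    have hhx := h.contMDiff.contMDiffAt (x := x)
    have hdσ (j) := FormField.mdifferentiableAt_apply hhx (F.mdifferentiableAt_Y h hU hx j) hσ
    have hdτ (j) := FormField.mdifferentiableAt_apply hhx (F.mdifferentiableAt_Y h hU hx j) hτ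
    have hY (j) (ρ : TangentSpace (𝓡 n) x) : h.inner x (cov (F.Y h j) x v) ρ =
        ∑ i, F.connectionForm h hx i j v * h.inner x (F.Y h i x) ρ := by
      rw [F.cov_Y h hx]
      simp [sum_apply, smul_apply, -Fintype.sum_sum_type]
    have hdσ' (j) := (hh.isParallelOn univ).deriv x (mem_univ x) _ _
      (F.mdifferentiableAt_Y h hU hx j) hσ v
    have hdτ' (j) := (hh.isParallelOn univ).deriv x (mem_univ x) _ _
      (F.mdifferentiableAt_Y h hU hx j) hτ v
    have hprod (j) : MDifferentiableAt (𝓡 n) 𝓘(ℝ)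
        (fun y ↦ h.inner y (F.Y h j y) (σ y) * h.inner y (F.Y h j y) (τ y)) x :=
      (hdσ j).mul (hdτ j)
    have hterm (j) : MDifferentiableAt (𝓡 n) 𝓘(ℝ) (fun y ↦ d (Quotient.mk _ j) *
        (h.inner y (F.Y h j y) (σ y) * h.inner y (F.Y h j y) (τ y))) x :=
      mdifferentiableAt_const.mul (hprod j)
    simp only [F.blockForm_apply]
    rw [(mvfderiv_fun_sum Finset.univ hterm).2, sum_apply]
    have hderiv (j) : mvfderiv (𝓡 n) (fun y ↦ d (Quotient.mk _ j) *
        (h.inner y (F.Y h j y) (σ y) * h.inner y (F.Y h j y) (τ y))) x v =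
        d (Quotient.mk _ j) * (h.inner x (F.Y h j x) (cov σ x v) * h.inner x (F.Y h j x) (τ x)) +
        d (Quotient.mk _ j) * (h.inner x (F.Y h j x) (σ x) * h.inner x (F.Y h j x) (cov τ x v)) +
        ∑ i, d (Quotient.mk _ j) * F.connectionForm h hx i j v *
          (h.inner x (F.Y h j x) (σ x) * h.inner x (F.Y h i x) (τ x) +
            h.inner x (F.Y h i x) (σ x) * h.inner x (F.Y h j x) (τ x)) := by
      rw [mvfderiv_fun_mul mdifferentiableAt_const (hprod j), mvfderiv_const,
        mvfderiv_fun_mul (hdσ j) (hdτ j)]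
      simp only [add_apply, smul_apply, smul_zero, add_zero, smul_eq_mul, hdσ', hdτ', hY]
      have hs (a b : ℝ) : ∑ i, d (Quotient.mk _ j) * F.connectionForm h hx i j v *
            (a * h.inner x (F.Y h i x) (τ x) + h.inner x (F.Y h i x) (σ x) * b) =
          d (Quotient.mk _ j) *
            (a * ∑ i, F.connectionForm h hx i j v * h.inner x (F.Y h i x) (τ x) +
              b * ∑ i, F.connectionForm h hx i j v * h.inner x (F.Y h i x) (σ x)) := by
        simp only [Finset.mul_sum, ← Finset.sum_add_distrib]
        exact Finset.sum_congr rfl fun i _ ↦ by ring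
      rw [hs]
      ring
    simp only [hderiv, Finset.sum_add_distrib]
    rw [add_eq_left]
    set T := fun j i ↦ d (Quotient.mk _ j) * F.connectionForm h hx i j v *
          (h.inner x (F.Y h j x) (σ x) * h.inner x (F.Y h i x) (τ x) +
            h.inner x (F.Y h i x) (σ x) * h.inner x (F.Y h j x) (τ x))
    have hT (i j) : T j i = -T i j := by
      simp only [T]
      by_cases hω : F.connectionForm h hx i j v = 0
      · have := F.connectionForm_antisymm hh hU hx i j v
        rw [hω, zero_eq_neg] at this
        simp [hω, this]
      · have hij : (Quotient.mk (F.blockSetoid h) i) = Quotient.mk _ j :=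
          Quotient.sound (Relation.EqvGen.rel _ _ ⟨x, hx, fun h0 ↦ hω (by simp [h0])⟩)
        rw [hij, F.connectionForm_antisymm hh hU hx i j v]
        ring
    have hsum : ∑ j, ∑ i, T j i = -∑ j, ∑ i, T j i := by
      conv_lhs => rw [Finset.sum_comm]
      simp only [← Finset.sum_neg_distrib]
      exact Finset.sum_congr rfl fun i _ ↦ Finset.sum_congr rfl fun j _ ↦ hT i j
    linarith

theorem inner_Y_eq (hh : IsParallel cov h) {x : M} (hx : x ∈ U) {B : FormField n M}
    (hB : ∀ i j, i ≠ j → B x (F.Y h i x) (F.Y h j x) = 0) (j : FrameIdx n)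
    (v : TangentSpace (𝓡 n) x) :
    B x (F.Y h j x) v = B x (F.Y h j x) (F.Y h j x) * h.inner x (F.Y h j x) v := by
  conv_lhs => rw [← F.sum_inner_smul_Y hh hx v, map_sum]
  rw [Finset.sum_eq_single j (fun i _ hi ↦ by rw [map_smul, hB j i hi.symm, smul_zero]) (by simp),
    map_smul, smul_eq_mul, mul_comm]

/-- On the domain of an eigenframe, a parallel metric is a combination of the restrictions of `h`
to the local blocks. -/
theorem exists_inner_Y_eq (hh : IsParallel cov h) (hU : IsOpen U) (hc : IsConnected U)
    {g : Metric n M} (hg : IsParallel cov g) : ∃ d : F.LocalBlock h → ℝ,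
      ∀ x ∈ U, ∀ j v, g.inner x (F.Y h j x) v =
        d (Quotient.mk _ j) * h.inner x (F.Y h j x) v := by
  have hoff {x} (hx : x ∈ U) (i j : FrameIdx n) (hij : i ≠ j) :
      g.inner x (F.Y h i x) (F.Y h j x) = 0 :=
    F.apply_Y_Y_eq_zero hh isOpen_univ (hg.isParallelOn univ) g.symm hx (mem_univ x) hij
  have hcov {x} (hx : x ∈ U) (i j : FrameIdx n) (v) : g.inner x (F.Y h i x) (cov (F.Y h j) x v) =
      F.connectionForm h hx i j v * g.inner x (F.Y h i x) (F.Y h i x) := by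
    rw [F.inner_Y_eq hh hx (hoff hx), F.connectionForm_eq_inner hh hx, mul_comm]
  obtain ⟨x₀, hx₀⟩ := hc.nonempty
  -- The derivative is twice ω^j_j g(Y_j, Y_j), and ω^j_j = 0 by antisymmetry.
  have hconst {x} (hx : x ∈ U) (j : FrameIdx n) :
      g.inner x (F.Y h j x) (F.Y h j x) = g.inner x₀ (F.Y h j x₀) (F.Y h j x₀) := by
    refine eq_of_mvfderiv_eq_zero (f := fun x ↦ g.inner x (F.Y h j x) (F.Y h j x)) hU
      hc.isPreconnected (fun y hy ↦ FormField.mdifferentiableAt_apply g.contMDiff.contMDiffAt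
        (F.mdifferentiableAt_Y h hU hy j) (F.mdifferentiableAt_Y h hU hy j))
      (fun y hy ↦ ?_) hx hx₀
    ext v
    have := F.connectionForm_antisymm hh hU hy j j v
    rw [(hg.isParallelOn univ).deriv y (mem_univ y) _ _ (F.mdifferentiableAt_Y h hU hy j)
      (F.mdifferentiableAt_Y h hU hy j), g.symm, hcov hy, show F.connectionForm h hy j j v = 0
      by linarith]
    simp
  -- By `Setoid.eqvGen_le` generating pairs suffice. Differentiating g(Y_i, Y_j) = 0 at a point
  -- where ω^i_j ≠ 0 equates the two diagonal entries.
  have hle : F.blockSetoid h ≤ Setoid.ker fun j ↦ g.inner x₀ (F.Y h j x₀) (F.Y h j x₀) := by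
    refine Setoid.eqvGen_le fun i j ⟨x, hx, hω⟩ ↦ ?_
    obtain ⟨v, hv⟩ : ∃ v, F.connectionForm h hx i j v ≠ 0 := by
      by_contra! h0
      exact hω (LinearMap.ext h0)
    change g.inner x₀ (F.Y h i x₀) (F.Y h i x₀) = g.inner x₀ (F.Y h j x₀) (F.Y h j x₀)
    by_cases hij : i = j
    · rw [hij]
    have hz : (fun y ↦ g.inner y (F.Y h i y) (F.Y h j y)) =ᶠ[𝓝 x] fun _ ↦ (0 : ℝ) := by
      filter_upwards [hU.mem_nhds hx] with y hy using hoff hy i j hij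
    have := (hg.isParallelOn univ).deriv x (mem_univ x) _ _ (F.mdifferentiableAt_Y h hU hx i)
      (F.mdifferentiableAt_Y h hU hx j) v
    rw [hz.mvfderiv_eq, mvfderiv_const, zero_apply, g.symm x (cov _ _ _), hcov hx, hcov hx,
      F.connectionForm_antisymm hh hU hx j i, hconst hx, hconst hx] at this
    have hmul : F.connectionForm h hx i j v * (g.inner x₀ (F.Y h i x₀) (F.Y h i x₀) -
      g.inner x₀ (F.Y h j x₀) (F.Y h j x₀)) = 0 := by linarith
    exact sub_eq_zero.1 ((mul_eq_zero.1 hmul).resolve_left hv)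
  refine ⟨Quotient.lift (s := F.blockSetoid h)
    (fun j ↦ g.inner x₀ (F.Y h j x₀) (F.Y h j x₀)) fun i j hij ↦ hle hij, fun x hx j v ↦ ?_⟩
  rw [F.inner_Y_eq hh hx (hoff hx), hconst hx]
  rfl

/-- Local blocks are invariant under the curvature operators, hence spanned by parts of any other
eigenframe. -/
theorem exists_Y_mem_localBundle (hh : IsParallel cov h) (hU : IsOpen U) {V : Set M}
    (G : EigenFrame cov V) {x : M} (hxU : x ∈ U) (hxV : x ∈ V) (j : FrameIdx n) :
    ∃ p, G.Y h j x ∈ F.localBundle h p x := by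
  classical
  set v := G.Y h j x with hv
  obtain ⟨i₀, hi₀⟩ : ∃ i, h.inner x (F.Y h i x) v ≠ 0 := by
    by_contra! h0
    refine G.Y_ne_zero (h := h) hxV j ?_
    rw [← hv, ← F.sum_inner_smul_Y hh hxU v]
    simp [h0]
  -- With this indicator, w is the h-orthogonal projection of v to the block of i₀, a block in which
  -- v has a nonzero component.
  let d : F.LocalBlock h → ℝ := fun p ↦ if p = Quotient.mk _ i₀ then 1 else 0
  have hd (p) : 0 ≤ d p := by simp only [d]; split_ifs <;> norm_num
  let w := ∑ i, (d (Quotient.mk _ i) * h.inner x (F.Y h i x) v) • F.Y h i x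
  have hw (u) : h.inner x u w = F.blockForm h d x v u := by
    simp only [w, map_sum, map_smul, F.blockForm_apply, smul_eq_mul, mul_assoc,
      h.symm x u, sum_apply, smul_apply]
  -- The block form is parallel on U, hence diagonal in the frame of G, so w has no component along
  -- the other vectors of that frame.
  have hwv : w = F.blockForm h d x v v • v := by
    rw [← G.sum_inner_smul_Y hh hxV w, Finset.sum_eq_single j]
    · rw [hw]
    · intro l _ hl
      have hsymm (x v w) : F.blockForm h d x v w = F.blockForm h d x w v := by
        simp only [F.blockForm_apply]
        exact Finset.sum_congr rfl fun _ _ ↦ by ring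
      rw [hw, hv, G.apply_Y_Y_eq_zero hh hU (F.isParallelOn_blockForm hh hU d) hsymm hxV hxU
        hl.symm, zero_smul]
    · simp
  have hμ : 0 < F.blockForm h d x v v := by
    rw [F.blockForm_apply]
    refine Finset.sum_pos' (fun i _ ↦ mul_nonneg (hd _) (mul_self_nonneg _))
      ⟨i₀, Finset.mem_univ _, ?_⟩
    simpa [d] using mul_self_pos.2 hi₀
  refine ⟨Quotient.mk _ i₀, ?_⟩
  have hmem : w ∈ F.localBundle h (Quotient.mk _ i₀) x := by
    refine Submodule.sum_mem _ fun i _ ↦ ?_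
    by_cases hi : Quotient.mk (F.blockSetoid h) i = Quotient.mk _ i₀
    · exact Submodule.smul_mem _ _ (Submodule.subset_span ⟨i, hi, rfl⟩)
    · simp [d, hi]
  have : v = (F.blockForm h d x v v)⁻¹ • w := by
    rw [eq_inv_smul_iff₀ hμ.ne', ← hwv]
  rw [this]
  exact Submodule.smul_mem _ _ hmem

end EigenFrame

/-! ### The global distributions -/

namespace EigenCover

variable [T2Space M] {cov : Connection n M} [cov.ContMDiffCovariantDerivative ∞]
  (C : EigenCover cov) {h : Metric n M}

/-- The block of `I` containing the `i`-th frame vector on `U`. -/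
def blockOf (h : Metric n M) (U : C.sets) (i : FrameIdx n) : C.Block h :=
  Quotient.mk (C.indexSetoid h) ⟨U, Quotient.mk _ i⟩

theorem exists_mem (x : M) : ∃ U : C.sets, x ∈ (U : Set M) := by
  obtain ⟨U, hU, hx⟩ := mem_sUnion.1 (C.covers ▸ mem_univ x)
  exact ⟨⟨U, hU⟩, hx⟩

theorem isOpen_coe (U : C.sets) : IsOpen (U : Set M) := C.isOpen U U.2

theorem distOn_eq_span (a : C.Block h) (U : C.sets) (x : M) :
    C.distOn h a U x =
      Submodule.span ℝ (((C.frame U).Y h · x) '' {i | C.blockOf h U i = a}) := by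
  apply le_antisymm
  · refine iSup₂_le fun p hp ↦ Submodule.span_le.2 ?_
    rintro _ ⟨j, rfl, rfl⟩
    exact Submodule.subset_span ⟨j, hp, rfl⟩
  · rw [Submodule.span_le]
    rintro _ ⟨j, hj, rfl⟩
    exact Submodule.mem_iSup_of_mem (Quotient.mk _ j)
      (Submodule.mem_iSup_of_mem hj (Submodule.subset_span ⟨j, rfl, rfl⟩))

/-- The vector lies in one local block of V. That block meets the vector's own block on U in a
nonzero vector, so the two are linked. -/
theorem Y_mem_distOn (hh : IsParallel cov h) {U V : C.sets} {x : M} (hxU : x ∈ (U : Set M))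
    (hxV : x ∈ (V : Set M)) (i : FrameIdx n) :
    (C.frame U).Y h i x ∈ C.distOn h (C.blockOf h U i) V x := by
  obtain ⟨p, hp⟩ := (C.frame V).exists_Y_mem_localBundle hh (C.isOpen_coe V) (C.frame U) hxV hxU i
  have hpi : (Quotient.mk (C.indexSetoid h) ⟨V, p⟩ : C.Block h) = C.blockOf h U i := by
    refine Quotient.sound (Relation.EqvGen.rel _ _ ⟨x, ⟨hxV, hxU⟩, fun hbot ↦ ?_⟩)
    have hmem : (C.frame U).Y h i x ∈ (C.frame V).localBundle h p x ⊓
        (C.frame U).localBundle h (Quotient.mk _ i) x :=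
      ⟨hp, Submodule.subset_span ⟨i, rfl, rfl⟩⟩
    rw [hbot, Submodule.mem_bot] at hmem
    exact (C.frame U).Y_ne_zero hxU i hmem
  exact Submodule.mem_iSup_of_mem p (Submodule.mem_iSup_of_mem hpi hp)

theorem distOn_le (hh : IsParallel cov h) {U V : C.sets} {x : M} (hxU : x ∈ (U : Set M))
    (hxV : x ∈ (V : Set M)) (a : C.Block h) : C.distOn h a U x ≤ C.distOn h a V x := by
  rw [C.distOn_eq_span a U, Submodule.span_le]
  rintro _ ⟨j, rfl, rfl⟩
  exact C.Y_mem_distOn hh hxU hxV j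

theorem dist_eq_distOn (hh : IsParallel cov h) (a : C.Block h) {U : C.sets} {x : M}
    (hx : x ∈ (U : Set M)) : C.dist h a x = C.distOn h a U x :=
  le_antisymm (iSup₂_le fun _ hV ↦ C.distOn_le hh hV hx a)
    (le_iSup₂_of_le (f := fun (U : C.sets) (_ : x ∈ (U : Set M)) ↦ C.distOn h a U x) U hx le_rfl)

theorem exists_blockOf_eq_of_mem (hh : IsParallel cov h) {U V : C.sets} {x : M}
    (hxU : x ∈ (U : Set M)) (hxV : x ∈ (V : Set M)) (i : FrameIdx n) :
    ∃ j, C.blockOf h V j = C.blockOf h U i := by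
  by_contra! hne
  have := C.Y_mem_distOn hh hxU hxV i
  have hempty : {j | C.blockOf h V j = C.blockOf h U i} = ∅ := by
    ext j
    simpa using hne j
  rw [C.distOn_eq_span, hempty, image_empty, Submodule.span_empty, Submodule.mem_bot] at this
  exact (C.frame U).Y_ne_zero hxU i this

theorem exists_eq_blockOf (a : C.Block h) : ∃ U i, C.blockOf h U i = a := by
  obtain ⟨⟨U, p⟩, rfl⟩ := Quotient.exists_rep a
  obtain ⟨i, rfl⟩ := Quotient.exists_rep p
  exact ⟨U, i, rfl⟩

/-- Every block meets every set of the cover. -/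
theorem exists_blockOf_eq [ConnectedSpace M] (hh : IsParallel cov h) (a : C.Block h)
    (V : C.sets) : ∃ j, C.blockOf h V j = a := by
  -- The set of points where the class is seen by some member of the cover. It is open, and so is
  -- its complement, because what one member sees at a point every other member containing that
  -- point sees too.
  let S := {x : M | ∃ U : C.sets, x ∈ (U : Set M) ∧ ∃ i, C.blockOf h U i = a}
  have key {x} {U V : C.sets} (hU : x ∈ (U : Set M)) (hV : x ∈ (V : Set M))
      (ha : ∃ i, C.blockOf h U i = a) : ∃ i, C.blockOf h V i = a := by
    obtain ⟨i, rfl⟩ := ha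
    exact C.exists_blockOf_eq_of_mem hh hU hV i
  have h1 : IsOpen S := isOpen_iff_mem_nhds.2 fun x ⟨U, hx, hi⟩ ↦
    Filter.mem_of_superset ((C.isOpen_coe U).mem_nhds hx) fun y hy ↦ ⟨U, hy, hi⟩
  have h2 : IsOpen Sᶜ := isOpen_iff_mem_nhds.2 fun x hx ↦ by
    obtain ⟨U, hU⟩ := C.exists_mem x
    refine Filter.mem_of_superset ((C.isOpen_coe U).mem_nhds hU) fun y hy ⟨W, hW, hi⟩ ↦ ?_
    exact hx ⟨U, hU, key hW hy hi⟩
  have hne : S.Nonempty := by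
    obtain ⟨U, i, hi⟩ := C.exists_eq_blockOf a
    obtain ⟨x, hx⟩ := (C.isConnected U U.2).nonempty
    exact ⟨x, U, hx, i, hi⟩
  have huniv := IsClopen.eq_univ ⟨⟨h2⟩, h1⟩ hne
  obtain ⟨x, hx⟩ := (C.isConnected V V.2).nonempty
  obtain ⟨U, hU, hi⟩ : x ∈ S := huniv ▸ mem_univ x
  exact key hU hx hi

theorem finite_block [ConnectedSpace M] (hh : IsParallel cov h) : Finite (C.Block h) := by
  obtain ⟨U, -⟩ := C.exists_mem (Classical.arbitrary M)
  exact Finite.of_surjective (C.blockOf h U) fun a ↦ C.exists_blockOf_eq hh a U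

theorem dist_ne_bot [ConnectedSpace M] (hh : IsParallel cov h) (a : C.Block h) (x : M) :
    C.dist h a x ≠ ⊥ := by
  obtain ⟨U, hU⟩ := C.exists_mem x
  obtain ⟨j, rfl⟩ := C.exists_blockOf_eq hh a U
  intro hbot
  have := C.Y_mem_distOn hh hU hU j
  rw [← C.dist_eq_distOn hh _ hU, hbot, Submodule.mem_bot] at this
  exact (C.frame U).Y_ne_zero hU j this

/-- On a set of the cover the Q_a are spanned by disjoint parts of one basis. -/
theorem iSupIndep_dist (hh : IsParallel cov h) (x : M) : iSupIndep (C.dist h · x) := by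
  obtain ⟨U, hU⟩ := C.exists_mem x
  have hli : LinearIndependent ℝ ((C.frame U).Y h · x) := by
    have := ((C.frame U).basisY h hU).linearIndependent
    rwa [show ⇑((C.frame U).basisY h hU) = ((C.frame U).Y h · x) from
      funext ((C.frame U).basisY_apply h hU)] at this
  intro a
  simp only [C.dist_eq_distOn hh _ hU, C.distOn_eq_span]
  rw [← Submodule.span_iUnion₂, ← image_iUnion₂]
  refine hli.disjoint_span_image (disjoint_left.2 fun i hi hi' ↦ ?_)
  obtain ⟨b, hb, hib⟩ := mem_iUnion₂.1 hi'
  exact hb (hib.symm.trans hi)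

theorem iSup_dist (hh : IsParallel cov h) (x : M) : ⨆ a, C.dist h a x = ⊤ := by
  obtain ⟨U, hU⟩ := C.exists_mem x
  rw [eq_top_iff, ← ((C.frame U).basisY h hU).span_eq, Submodule.span_le]
  rintro _ ⟨j, rfl⟩
  rw [(C.frame U).basisY_apply h hU]
  refine Submodule.mem_iSup_of_mem (C.blockOf h U j) ?_
  rw [C.dist_eq_distOn hh _ hU]
  exact C.Y_mem_distOn hh hU hU j

/-! ### Contravariant forms and restrictions of the metric -/

/-- The covector `h(Y_j, ·)` lies in the dual subbundle of the block of `j`. -/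
theorem inner_Y_mem_dualDist (hh : IsParallel cov h) {U : C.sets} {x : M} (hx : x ∈ (U : Set M))
    (j : FrameIdx n) :
    h.inner x ((C.frame U).Y h j x) ∈ C.dualDist h (C.blockOf h U j) x := by
  classical
  intro b hb v hv
  rw [C.dist_eq_distOn hh _ hx, C.distOn_eq_span] at hv
  induction hv using Submodule.span_induction with
  | mem v hv =>
    obtain ⟨i, hi, rfl⟩ := hv
    dsimp only
    rw [(C.frame U).inner_Y_Y hh hx, if_neg]
    rintro rfl
    exact hb hi.symm
  | zero => simp
  | add v w _ _ hv hw => rw [map_add, hv, hw, add_zero]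
  | smul c v _ hv => rw [map_smul, hv, smul_zero]

theorem apply_Y_eq_zero (hh : IsParallel cov h) {U : C.sets} {x : M} (hx : x ∈ (U : Set M))
    {b : C.Block h} {σ : TangentSpace (𝓡 n) x →L[ℝ] ℝ} (hσ : σ ∈ C.dualDist h b x)
    {j : FrameIdx n} (hj : C.blockOf h U j ≠ b) : σ ((C.frame U).Y h j x) = 0 := by
  refine hσ _ hj _ ?_
  rw [C.dist_eq_distOn hh _ hx]
  exact C.Y_mem_distOn hh hx hx j

/-- The contravariant form of a metric that is diagonal in the frame `Y`. -/
theorem contra_apply (hh : IsParallel cov h) {g : Metric n M} {U : C.sets} {x : M}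
    (hx : x ∈ (U : Set M)) {f : FrameIdx n → ℝ} (hf : ∀ j, f j ≠ 0)
    (hg : ∀ j v, g.inner x ((C.frame U).Y h j x) v = f j * h.inner x ((C.frame U).Y h j x) v)
    (σ τ : TangentSpace (𝓡 n) x →L[ℝ] ℝ) :
    g.contra x σ τ = ∑ j, (f j)⁻¹ * (σ ((C.frame U).Y h j x) * τ ((C.frame U).Y h j x)) := by
  -- The vector g-dual to σ; the diagonal form of g is inverted entrywise.
  let w (σ : TangentSpace (𝓡 n) x →L[ℝ] ℝ) : TangentSpace (𝓡 n) x :=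
    ∑ j, ((f j)⁻¹ * σ ((C.frame U).Y h j x)) • (C.frame U).Y h j x
  have hw (σ) (v) : g.inner x (w σ) v = σ v := by
    conv_rhs => rw [← (C.frame U).sum_inner_smul_Y hh hx v]
    simp only [w, map_sum, map_smul, sum_apply, smul_apply, smul_eq_mul, hg]
    refine Finset.sum_congr rfl fun j _ ↦ ?_
    field_simp [hf j]
  have hflat (σ) : (g.flat x).symm σ = w σ := by
    rw [LinearEquiv.symm_apply_eq]
    ext v
    exact (hw σ v).symm
  change g.inner x ((g.flat x).symm σ) ((g.flat x).symm τ) = _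
  rw [hflat, hflat, hw]
  simp only [w, map_sum, map_smul, smul_eq_mul]
  exact Finset.sum_congr rfl fun j _ ↦ by ring

theorem contra_self_apply (hh : IsParallel cov h) {U : C.sets} {x : M}
    (hx : x ∈ (U : Set M)) (σ τ : TangentSpace (𝓡 n) x →L[ℝ] ℝ) :
    h.contra x σ τ = ∑ j, σ ((C.frame U).Y h j x) * τ ((C.frame U).Y h j x) := by
  simpa [-Fintype.sum_sum_type] using
    C.contra_apply hh hx (g := h) (f := fun _ ↦ 1) (by simp) (by simp) σ τ

-- The covectors h(Y_j, ·) form the frame dual to Y, and each lies in one Q_b^*, so the restriction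
-- conditions fix every matrix entry of H a.
open Classical in
theorem isRestriction_apply (hh : IsParallel cov h) {H : C.Block h → CoTensor n M}
    (hH : C.IsRestriction h H) (a : C.Block h) {U : C.sets} {x : M} (hx : x ∈ (U : Set M))
    (σ τ : TangentSpace (𝓡 n) x →L[ℝ] ℝ) :
    H a x σ τ = ∑ j, if C.blockOf h U j = a then
      σ ((C.frame U).Y h j x) * τ ((C.frame U).Y h j x) else 0 := by
  have hexp (σ : TangentSpace (𝓡 n) x →L[ℝ] ℝ) :
      σ = ∑ j, σ ((C.frame U).Y h j x) • h.inner x ((C.frame U).Y h j x) := by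
    ext v
    conv_lhs => rw [← (C.frame U).sum_inner_smul_Y hh hx v]
    simp only [map_sum, map_smul, sum_apply, smul_apply, smul_eq_mul, mul_comm]
  have hoff (i j) : H a x (h.inner x ((C.frame U).Y h i x)) (h.inner x ((C.frame U).Y h j x)) =
      if i = j ∧ C.blockOf h U j = a then 1 else 0 := by
    rw [hH a _ _ x _ (C.inner_Y_mem_dualDist hh hx i) _ (C.inner_Y_mem_dualDist hh hx j),
      C.contra_self_apply hh hx]
    simp only [(C.frame U).inner_Y_Y hh hx]
    by_cases hij : i = j
    · subst hij
      simp [-Fintype.sum_sum_type]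
    · simp [hij, -Fintype.sum_sum_type]
  conv_lhs => rw [hexp σ, hexp τ]
  simp only [map_sum, map_smul, LinearMap.sum_apply, LinearMap.smul_apply, smul_eq_mul,
    hoff]
  refine Finset.sum_congr rfl fun j _ ↦ ?_
  rw [Finset.sum_eq_single j]
  · by_cases hj : C.blockOf h U j = a
    · simp [hj, mul_comm]
    · simp [hj]
  · intro i _ hi
    simp [hi]
  · simp

/-- A single set around each point suffices, so existence can use an arbitrary choice of sets, with
no compatibility to check. -/
theorem isRestriction_of_apply (hh : IsParallel cov h) {H : C.Block h → CoTensor n M}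
    (hH : ∀ a x, ∃ U : C.sets, x ∈ (U : Set M) ∧ ∀ σ τ, H a x σ τ =
      open Classical in ∑ j, if C.blockOf h U j = a then
        σ ((C.frame U).Y h j x) * τ ((C.frame U).Y h j x) else 0) : C.IsRestriction h H := by
  classical
  intro a b c x σ hσ τ hτ
  obtain ⟨U, hx, hU⟩ := hH a x
  rw [hU]
  split_ifs with habc
  · obtain ⟨rfl, rfl⟩ := habc
    rw [C.contra_self_apply hh hx]
    refine Finset.sum_congr rfl fun j _ ↦ ?_
    split_ifs with hj
    · rfl
    · rw [C.apply_Y_eq_zero hh hx hσ hj, zero_mul]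
  · refine Finset.sum_eq_zero fun j _ ↦ ?_
    split_ifs with hj
    · rw [not_and_or] at habc
      rcases habc with hb | hc
      · rw [C.apply_Y_eq_zero hh hx hσ (by rw [hj]; exact Ne.symm hb), zero_mul]
      · rw [C.apply_Y_eq_zero hh hx hτ (by rw [hj]; exact Ne.symm hc), mul_zero]
    · rfl

theorem existsUnique_isRestriction (hh : IsParallel cov h) : ∃! H, C.IsRestriction h H := by
  classical
  choose U hU using C.exists_mem
  refine ⟨fun a x ↦ LinearMap.mk₂ ℝ (fun σ τ ↦ ∑ j, if C.blockOf h (U x) j = a then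
      σ ((C.frame (U x)).Y h j x) * τ ((C.frame (U x)).Y h j x) else 0) ?_ ?_ ?_ ?_, ?_, ?_⟩
  · intro σ σ' τ
    simp only [← Finset.sum_add_distrib, add_apply]
    exact Finset.sum_congr rfl fun j _ ↦ by split_ifs <;> ring
  · intro c σ τ
    simp only [Finset.mul_sum, smul_apply, smul_eq_mul]
    exact Finset.sum_congr rfl fun j _ ↦ by split_ifs <;> ring
  · intro σ τ τ'
    simp only [← Finset.sum_add_distrib, add_apply]
    exact Finset.sum_congr rfl fun j _ ↦ by split_ifs <;> ring
  · intro c σ τ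
    simp only [Finset.mul_sum, smul_apply, smul_eq_mul]
    exact Finset.sum_congr rfl fun j _ ↦ by split_ifs <;> ring
  · exact C.isRestriction_of_apply hh fun a x ↦ ⟨U x, hU x, fun σ τ ↦ rfl⟩
  · intro H hH
    funext a x
    refine LinearMap.ext₂ fun σ τ ↦ ?_
    exact C.isRestriction_apply hh hH a (hU x) σ τ

theorem isPosSemidef_of_isRestriction (hh : IsParallel cov h) {H : C.Block h → CoTensor n M}
    (hH : C.IsRestriction h H) (a : C.Block h) (x : M) : (H a x).IsPosSemidef := by
  classical
  obtain ⟨U, hx⟩ := C.exists_mem x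
  refine LinearMap.BilinForm.isPosSemidef_def.2 ⟨⟨fun σ τ ↦ ?_⟩, ⟨fun σ ↦ ?_⟩⟩
  · simp only [C.isRestriction_apply hh hH a hx, mul_comm]
  · rw [C.isRestriction_apply hh hH a hx]
    refine Finset.sum_nonneg fun j _ ↦ ?_
    split_ifs
    · exact mul_self_nonneg _
    · exact le_rfl

end EigenCover

/-! ### Gluing: parallel metrics and block scalings -/

theorem IsParallelOn.congr {cov : Connection n M} {B B' : FormField n M} {U : Set M}
    (hB : IsParallelOn cov B U) (hU : IsOpen U) (h : ∀ x ∈ U, B' x = B x) :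
    IsParallelOn cov B' U where
  smooth := hB.smooth.congr fun x hx ↦ by rw [h x hx]
  deriv x hx σ τ hσ hτ v := by
    have : (fun y ↦ B' y (σ y) (τ y)) =ᶠ[𝓝 x] fun y ↦ B y (σ y) (τ y) := by
      filter_upwards [hU.mem_nhds hx] with y hy
      rw [h y hy]
    rw [this.mvfderiv_eq, h x hx, hB.deriv x hx σ τ hσ hτ]

namespace EigenFrame

variable [T2Space M] {cov : Connection n M} [cov.ContMDiffCovariantDerivative ∞] {U : Set M}
  (F : EigenFrame cov U) {h : Metric n M}

theorem blockForm_Y (hh : IsParallel cov h) {x : M} (hx : x ∈ U) (d : F.LocalBlock h → ℝ)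
    (j : FrameIdx n) (v : TangentSpace (𝓡 n) x) :
    F.blockForm h d x (F.Y h j x) v = d (Quotient.mk _ j) * h.inner x (F.Y h j x) v := by
  classical
  rw [F.blockForm_apply, Finset.sum_eq_single j]
  · simp [F.inner_Y_Y hh hx]
  · intro i _ hi
    simp [F.inner_Y_Y hh hx, hi]
  · simp

theorem inner_eq_sum (hh : IsParallel cov h) {x : M} (hx : x ∈ U) (v w : TangentSpace (𝓡 n) x) :
    h.inner x v w = ∑ j, h.inner x (F.Y h j x) v * h.inner x (F.Y h j x) w := by
  conv_lhs => rw [← F.sum_inner_smul_Y hh hx v]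
  simp [sum_apply, -Fintype.sum_sum_type]

/-- The smallest coefficient serves as ε. The bound yields both positivity and boundedness of the
unit balls of the glued metric. -/
theorem exists_mul_inner_le_blockForm (hh : IsParallel cov h) {x : M} (hx : x ∈ U)
    {d : F.LocalBlock h → ℝ} (hd : ∀ p, 0 < d p) :
    ∃ ε > 0, ∀ v, ε * h.inner x v v ≤ F.blockForm h d x v v := by
  have : Finite (F.LocalBlock h) := Quotient.finite _
  obtain ⟨ε, hε, hle⟩ : ∃ ε > 0, ∀ p, ε ≤ d p := by
    rcases isEmpty_or_nonempty (F.LocalBlock h) with he | he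
    · exact ⟨1, one_pos, fun p ↦ he.elim p⟩
    · obtain ⟨p, hp⟩ := Finite.exists_min d
      exact ⟨d p, hd p, hp⟩
  refine ⟨ε, hε, fun v ↦ ?_⟩
  rw [F.inner_eq_sum hh hx, F.blockForm_apply, Finset.mul_sum]
  exact Finset.sum_le_sum fun j _ ↦ mul_le_mul_of_nonneg_right (hle _) (mul_self_nonneg _)

end EigenFrame

namespace EigenCover

variable [T2Space M] {cov : Connection n M} [cov.ContMDiffCovariantDerivative ∞]
  (C : EigenCover cov) {h : Metric n M}

/-- A parallel metric is a constant multiple of `h` on each block. -/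
theorem exists_scaling (hh : IsParallel cov h) {g : Metric n M} (hg : IsParallel cov g) :
    ∃ f : C.Block h → ℝ, (∀ a, 0 < f a) ∧ ∀ (U : C.sets), ∀ x ∈ (U : Set M), ∀ j v,
      g.inner x ((C.frame U).Y h j x) v =
        f (C.blockOf h U j) * h.inner x ((C.frame U).Y h j x) v := by
  choose d hd using fun U : C.sets ↦
    (C.frame U).exists_inner_Y_eq hh (C.isOpen_coe U) (C.isConnected U U.2) hg
  have hloc (U : C.sets) (p) {x : M} (hx : x ∈ (U : Set M)) (v)
      (hv : v ∈ (C.frame U).localBundle h p x) (w) :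
      g.inner x v w = d U p * h.inner x v w := by
    induction hv using Submodule.span_induction with
    | mem v hv =>
      obtain ⟨j, rfl, rfl⟩ := hv
      exact hd U x hx j w
    | zero => simp
    | add u v _ _ hu hv => simp [add_apply, hu, hv, mul_add]
    | smul c v _ hv =>
      simp only [map_smul, smul_apply, hv, smul_eq_mul]
      ring
  -- For linked blocks, compute g(v, v) for a common nonzero v with either constant.
  have hle : C.indexSetoid h ≤ Setoid.ker fun p : C.Index h ↦ d p.1 p.2 := by
    refine Setoid.eqvGen_le fun p q ⟨x, hx, hne⟩ ↦ ?_
    obtain ⟨v, hv, hv0⟩ := (Submodule.ne_bot_iff _).1 hne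
    exact mul_right_cancel₀ (h.pos x v hv0).ne'
      ((hloc p.1 p.2 hx.1 v hv.1 v).symm.trans (hloc q.1 q.2 hx.2 v hv.2 v))
  refine ⟨Quotient.lift (s := C.indexSetoid h) (fun p ↦ d p.1 p.2) fun p q hpq ↦ hle hpq,
    fun a ↦ ?_, fun U x hx j v ↦ hd U x hx j v⟩
  obtain ⟨U, j, rfl⟩ := C.exists_eq_blockOf a
  obtain ⟨x, hx⟩ := (C.isConnected U U.2).nonempty
  have hY := (C.frame U).Y_ne_zero (h := h) hx j
  have h1 := g.pos x _ hY
  rw [hd U x hx] at h1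
  exact pos_of_mul_pos_left h1 (h.pos x _ hY).le

/-- The parallel form scaling `h` by `f a` on the block `a`, over a set of the cover. -/
def scaledForm (h : Metric n M) (f : C.Block h → ℝ) (U : C.sets) : FormField n M :=
  (C.frame U).blockForm h fun p ↦ f (Quotient.mk _ ⟨U, p⟩)

/-- The frame vector of V lies in the span of those frame vectors of U that belong to the same
class, and on all of these the factor is the same. The right side does not mention U, so the local
forms agree on overlaps. -/
theorem scaledForm_Y (hh : IsParallel cov h) (f : C.Block h → ℝ) {U V : C.sets} {x : M}
    (hU : x ∈ (U : Set M)) (hV : x ∈ (V : Set M)) (j : FrameIdx n) (w : TangentSpace (𝓡 n) x) :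
    C.scaledForm h f U x ((C.frame V).Y h j x) w =
      f (C.blockOf h V j) * h.inner x ((C.frame V).Y h j x) w := by
  have hmem := C.Y_mem_distOn hh hV hU j
  generalize (C.frame V).Y h j x = v at hmem
  rw [C.distOn_eq_span] at hmem
  induction hmem using Submodule.span_induction with
  | mem v hv =>
    obtain ⟨i, hi, rfl⟩ := hv
    rw [← hi]
    exact (C.frame U).blockForm_Y hh hU _ i w
  | zero => simp
  | add u v _ _ hu hv => simp [add_apply, hu, hv, mul_add]
  | smul c v _ hv =>
    simp only [map_smul, smul_apply, hv, smul_eq_mul]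
    ring

theorem scaledForm_eq (hh : IsParallel cov h) (f : C.Block h → ℝ) {U V : C.sets} {x : M}
    (hU : x ∈ (U : Set M)) (hV : x ∈ (V : Set M)) :
    C.scaledForm h f U x = C.scaledForm h f V x := by
  ext v w
  rw [← (C.frame V).sum_inner_smul_Y hh hV v]
  simp only [map_sum, map_smul, sum_apply, smul_apply]
  exact Finset.sum_congr rfl fun j _ ↦ by
    rw [C.scaledForm_Y hh f hU hV, C.scaledForm_Y hh f hV hV]

theorem exists_parallel_metric (hh : IsParallel cov h) {f : C.Block h → ℝ} (hf : ∀ a, 0 < f a) :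
    ∃ g : Metric n M, IsParallel cov g ∧ ∀ (U : C.sets), ∀ x ∈ (U : Set M), ∀ j v,
      g.inner x ((C.frame U).Y h j x) v =
        f (C.blockOf h U j) * h.inner x ((C.frame U).Y h j x) v := by
  choose U hU using C.exists_mem
  have hpar (V : C.sets) : IsParallelOn cov (fun x ↦ C.scaledForm h f (U x) x) V :=
    ((C.frame V).isParallelOn_blockForm hh (C.isOpen_coe V) _).congr (C.isOpen_coe V)
      fun x hx ↦ C.scaledForm_eq hh f (hU x) hx
  have hlow (x : M) : ∃ ε > 0, ∀ v, ε * h.inner x v v ≤ C.scaledForm h f (U x) x v v :=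
    (C.frame (U x)).exists_mul_inner_le_blockForm hh (hU x) fun p ↦ hf _
  let g : Metric n M :=
    { inner := fun x ↦ C.scaledForm h f (U x) x
      symm := fun x v w ↦ by
        simp only [scaledForm, (C.frame (U x)).blockForm_apply]
        exact Finset.sum_congr rfl fun _ _ ↦ by ring
      pos := fun x v hv ↦ by
        obtain ⟨ε, hε, hle⟩ := hlow x
        exact (mul_pos hε (h.pos x v hv)).trans_le (hle v)
      isVonNBounded := fun x ↦ by
        obtain ⟨ε, hε, hle⟩ := hlow x
        -- The unit ball of the new metric is contained in that of h dilated by 1/√ε.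
        refine ((h.isVonNBounded x).image
          ((Real.sqrt ε)⁻¹ • ContinuousLinearMap.id ℝ (TangentSpace (𝓡 n) x))).subset ?_
        intro v hv
        have hs := (Real.sqrt_pos.2 hε).ne'
        refine ⟨Real.sqrt ε • v, ?_, ?_⟩
        · have h1 : h.inner x (Real.sqrt ε • v) (Real.sqrt ε • v) = ε * h.inner x v v := by
            simp only [map_smul, smul_apply, smul_eq_mul]
            rw [← mul_assoc, Real.mul_self_sqrt hε.le]
          rw [mem_ofPred_eq, h1]
          exact (hle v).trans_lt hv
        · rw [smul_apply, ContinuousLinearMap.id_apply, smul_smul, inv_mul_cancel₀ hs, one_smul]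
      contMDiff := fun x ↦ (hpar (U x)).smooth.contMDiffAt ((C.isOpen_coe _).mem_nhds (hU x)) }
  exact ⟨g, isParallel_of_isParallelOn fun x ↦ ⟨U x, hU x, hpar (U x)⟩,
    fun V x hx j v ↦ C.scaledForm_Y hh f (hU x) hx j v⟩

/-- Inverting a form that is diagonal in an h-orthonormal frame inverts its entries; grouping them
by class gives the sum. -/
theorem contra_eq_sum [Fintype (C.Block h)] (hh : IsParallel cov h)
    {H : C.Block h → CoTensor n M} (hH : C.IsRestriction h H) {g : Metric n M}
    {f : C.Block h → ℝ} (hf : ∀ a, 0 < f a)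
    (hg : ∀ (U : C.sets), ∀ x ∈ (U : Set M), ∀ j v, g.inner x ((C.frame U).Y h j x) v =
      f (C.blockOf h U j) * h.inner x ((C.frame U).Y h j x) v) :
    g.contra = ∑ a, (f a)⁻¹ • H a := by
  classical
  funext x
  obtain ⟨U, hU⟩ := C.exists_mem x
  refine LinearMap.ext₂ fun σ τ ↦ ?_
  rw [C.contra_apply hh hU (f := fun j ↦ f (C.blockOf h U j)) (fun j ↦ (hf _).ne') (hg U x hU)]
  simp only [Finset.sum_apply, Pi.smul_apply, LinearMap.sum_apply, LinearMap.smul_apply,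
    smul_eq_mul, C.isRestriction_apply hh hH _ hU, Finset.mul_sum]
  rw [Finset.sum_comm]
  refine Finset.sum_congr rfl fun j _ ↦ ?_
  rw [Finset.sum_eq_single (C.blockOf h U j)]
  · simp
  · intro b _ hb
    simp [hb.symm]
  · simp

end EigenCover

end ParallelMetric

end

open ParallelMetric in
theorem theorem1 {n : ℕ} {M : Type*} [TopologicalSpace M] [T2Space M] [ConnectedSpace M]
    [ChartedSpace (EuclideanSpace ℝ (Fin n)) M] [IsManifold (𝓡 n) ∞ M]
    (h : Metric n M) (cov : Connection n M) [cov.ContMDiffCovariantDerivative ∞]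
    (hcov : IsLeviCivita cov h) (hgen : IsGeneric cov) (C : EigenCover cov) :
    ∃ _ : Fintype (C.Block h),
      (∀ a, ∀ U : C.sets, ∀ x ∈ (U : Set M), C.dist h a x = C.distOn h a U x) ∧
      (∀ a x, C.dist h a x ≠ ⊥) ∧
      (∀ x, iSupIndep (C.dist h · x) ∧ ⨆ a, C.dist h a x = ⊤) ∧
      (∃! H, C.IsRestriction h H) ∧
      ∀ H, C.IsRestriction h H →
        (∀ a x, (H a x).IsPosSemidef) ∧
        ∀ G : CoTensor n M, IsParallelMetric cov G ↔
          ∃ c : C.Block h → ℝ, (∀ a, 0 < c a) ∧ G = ∑ a, c a • H a := by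
  have hh := hcov.2
  have := C.finite_block hh
  let _ := Fintype.ofFinite (C.Block h)
  refine ⟨inferInstance, fun a U x hx ↦ C.dist_eq_distOn hh a hx, C.dist_ne_bot hh,
    fun x ↦ ⟨C.iSupIndep_dist hh x, C.iSup_dist hh x⟩, C.existsUnique_isRestriction hh,
    fun H hH ↦ ⟨C.isPosSemidef_of_isRestriction hh hH, fun G ↦ ⟨?_, ?_⟩⟩⟩
  · rintro ⟨g, rfl, hg⟩
    obtain ⟨f, hf, hfg⟩ := C.exists_scaling hh hg
    exact ⟨fun a ↦ (f a)⁻¹, fun a ↦ inv_pos.2 (hf a), C.contra_eq_sum hh hH hf hfg⟩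
  -- Covariant scalings are the reciprocals of the contravariant coefficients.
  · rintro ⟨c, hc, rfl⟩
    obtain ⟨g, hg, hgf⟩ := C.exists_parallel_metric hh fun a ↦ inv_pos.2 (hc a)
    refine ⟨g, ?_, hg⟩
    rw [C.contra_eq_sum hh hH (fun a ↦ inv_pos.2 (hc a)) hgf]
    simp only [inv_inv]
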